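/- Let $d\ge 2$, $k>0$, $f\in L^1_{loc}(\mathbb R^d;\mathbb C)$, and let $n\in L^\infty(\mathbb R^d)$ be real-valued with $n\ge n_*>0$ almost everywhere for some constant $n_*$. Let $n_\sharp(r)=\frac1{|\partial B_r|}\int_{\partial B_r} n\,d\sigma$ be the spherical mean of $n$, where $B_r$ is the open ball of radius $r$ centred at the origin, and assume that $$\Big\|1-\frac{n_\sharp(|x|)}{n(x)}\Big\|_{L^\infty(\mathbb R^d)}<1 .$$ For an open set $\Omega\subseteq\mathbb R^d$ call $u$ a weak solution of $\Delta u+k^2n^2u=f$ in $\Omega$ if $$-\int_\Omega\nabla u\cdot\nabla\overline\varphi\,dx+k^2\int_\Omega n^2u\overline\varphi\,dx=\int_\Omega f\overline\varphi\,dx\qquad\text{for all }\varphi\in C^1_c(\Omega;\mathbb C).$$ Assume that there is exactly one (up to null sets) function $U\in H^1_{loc}(\mathbb R^d;\mathbb C)$ that is a weak solution in $\mathbb R^d$ and satisfies the radiation condition $$\int_{\mathbb R^d}\Big|\nabla U-iknU\frac{x}{|x|}\Big|^2\frac{dx}{1+|x|}<\infty .$$ For $R>0$ let $\mathcal D_R$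 be the set of all weak solutions $u\in H^1(B_R;\mathbb C)$ in $B_R$, and put $$[u]_R=\Big(\int_{B_R}\Big|\nabla u-iknu\frac{x}{|x|}\Big|^2\frac{dx}{1+|x|}\Big)^{1/2}.$$ Then for every $R>0$ the seminorm $[\cdot]_R$ has a minimizer $u_{B_R}$ over $\mathcal D_R$, unique up to null sets, and for every $R_0>0$ $$\lim_{R\to+\infty}\|u_{B_R}-U\|_{H^1(B_{R_0})}=0 .$$ -/

import Mathlib

open MeasureTheory Filter Topology Metric
open scoped ENNReal ContDiff

noncomputable section

namespace Helmholtz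

/-- `d`-dimensional Euclidean space `ℝ^d`. -/
abbrev E (d : ℕ) : Type := EuclideanSpace ℝ (Fin d)

/-- `d`-dimensional complex vectors, with the Hermitian norm (values of gradients). -/
abbrev V (d : ℕ) : Type := EuclideanSpace ℂ (Fin d)

/-- `g` is a weak gradient of `u` in the open set `Ω`: both are locally integrable in `Ω` and
`∫_Ω u ∂ᵢφ = - ∫_Ω gᵢ φ` for every `φ ∈ C_c^∞(Ω)` and every `i`. -/
def HasWeakGradOn {d : ℕ} (Ω : Set (E d)) (u : E d → ℂ) (g : E d → V d) : Prop :=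
  LocallyIntegrableOn u Ω volume ∧ LocallyIntegrableOn g Ω volume ∧
    ∀ φ : E d → ℝ, ContDiff ℝ ∞ φ → HasCompactSupport φ → tsupport φ ⊆ Ω → ∀ i : Fin d,
      ∫ x in Ω, ((fderiv ℝ φ x (EuclideanSpace.single i 1) : ℝ) : ℂ) * u x
        = - ∫ x in Ω, (φ x : ℂ) * g x i

open Classical in
/-- The weak gradient `∇u` of `u` in the open set `Ω` (unique up to null subsets of `Ω`;
the value `0` is used if `u` has no weak gradient in `Ω`). -/
def weakGrad {d : ℕ} (Ω : Set (E d)) (u : E d → ℂ) : E d → V d :=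
  if h : ∃ g, HasWeakGradOn Ω u g then h.choose else 0

/-- `u ∈ H¹(Ω)`: `u ∈ L²(Ω)`, and `u` has a weak gradient in `Ω` that belongs to `L²(Ω)`. -/
def MemH1 {d : ℕ} (Ω : Set (E d)) (u : E d → ℂ) : Prop :=
  MemLp u 2 (volume.restrict Ω) ∧
    ∃ g : E d → V d, HasWeakGradOn Ω u g ∧ MemLp g 2 (volume.restrict Ω)

open Classical in
/-- The norm `(∫_Ω |u|² + |∇u|²)^{1/2}` of `H¹(Ω)`, equal to `∞` if `u ∉ H¹(Ω)`. -/
def h1Norm {d : ℕ} (Ω : Set (E d)) (u : E d → ℂ) : ℝ≥0∞ :=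
  if MemH1 Ω u then
    (∫⁻ x in Ω, (‖u x‖ₑ ^ 2 + ‖weakGrad Ω u x‖ₑ ^ 2)) ^ (1 / 2 : ℝ)
  else ⊤

/-- The classical gradient of a complex-valued function. -/
def grad {d : ℕ} (φ : E d → ℂ) (x : E d) : V d :=
  WithLp.toLp 2 fun i => fderiv ℝ φ x (EuclideanSpace.single i 1)

/-- The variational formulation of `Δu + k² n² u = f` in `Ω`:
`-∫_Ω ∇u · ∇φ̄ + k² ∫_Ω n² u φ̄ = ∫_Ω f φ̄` for all complex-valued `φ ∈ C_c^1(Ω)`.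
(`inner ℂ a b` is `∑ᵢ conj(aᵢ) bᵢ`.) -/
def IsWeakSolution {d : ℕ} (k : ℝ) (n : E d → ℝ) (f : E d → ℂ) (Ω : Set (E d))
    (u : E d → ℂ) : Prop :=
  ∀ φ : E d → ℂ, ContDiff ℝ 1 φ → HasCompactSupport φ → tsupport φ ⊆ Ω →
    -(∫ x in Ω, inner ℂ (grad φ x) (weakGrad Ω u x))
        + (k : ℂ) ^ 2 * ∫ x in Ω, (n x : ℂ) ^ 2 * u x * starRingEnd ℂ (φ x)
      = ∫ x in Ω, f x * starRingEnd ℂ (φ x)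

/-- The unit radial field `x / |x|`, seen as a complex vector. -/
def radialDir {d : ℕ} (x : E d) : V d :=
  WithLp.toLp 2 fun i => ((x i / ‖x‖ : ℝ) : ℂ)

/-- The weighted radiation seminorm
`(∫_Ω |∇u - i k n u x/|x||² dx / (1 + |x|))^{1/2}`. -/
def radSeminorm {d : ℕ} (k : ℝ) (n : E d → ℝ) (Ω : Set (E d)) (u : E d → ℂ) : ℝ≥0∞ :=
  (∫⁻ x in Ω,
      ‖weakGrad Ω u x - (Complex.I * (k : ℂ) * (n x : ℂ) * u x) • radialDir x‖ₑ ^ 2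
        / ENNReal.ofReal (1 + ‖x‖)) ^ (1 / 2 : ℝ)

/-- The set `D_R` of `H¹` weak solutions in the ball `B_R` centred at the origin. -/
def solutionSet {d : ℕ} (k : ℝ) (n : E d → ℝ) (f : E d → ℂ) (R : ℝ) : Set (E d → ℂ) :=
  {u | MemH1 (ball 0 R) u ∧ IsWeakSolution k n f (ball 0 R) u}

/-- `u` is a minimizer of `[·]_R` over `D_R`. -/
def IsMinimizer {d : ℕ} (k : ℝ) (n : E d → ℝ) (f : E d → ℂ) (R : ℝ) (u : E d → ℂ) : Prop :=
  u ∈ solutionSet k n f R ∧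
    IsMinOn (radSeminorm k n (ball 0 R)) (solutionSet k n f R) u

/-- `u` is an outgoing solution: an `H¹_loc` weak solution in the whole space that satisfies the
radiation condition `∫_{ℝ^d} |∇u - i k n u x/|x||² dx / (1 + |x|) < ∞`. -/
def IsOutgoing {d : ℕ} (k : ℝ) (n : E d → ℝ) (f : E d → ℂ) (u : E d → ℂ) : Prop :=
  (∀ R : ℝ, 0 < R → MemH1 (ball 0 R) u) ∧
    IsWeakSolution k n f Set.univ u ∧ radSeminorm k n Set.univ u < ⊤

/-- The spherical mean `n_♯(r) = |∂B_r|⁻¹ ∫_{∂B_r} n dσ`, written as the average of `n(rθ)` over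
the unit sphere with respect to surface measure. -/
def sphereMean {d : ℕ} (n : E d → ℝ) (r : ℝ) : ℝ :=
  ⨍ θ : sphere (0 : E d) 1, n (r • (θ : E d)) ∂((volume : Measure (E d)).toSphere)

end Helmholtz

end

open scoped Convolution

/-! The engine is a coercivity estimate for homogeneous solutions. Testing the equation for `u` with
`ψ u`, `ψ` real and radial, and taking imaginary parts removes every real term and leaves `∫ w(|x|)
Im(ū ∂ᵣu) = 0` for radial weights `w` (`IsSolPair.integral_radial_mul_flux`). On the other hand
`[u]_R²` is the integral over `B_R` of `(|∇u|² - 2kn Im(ū ∂ᵣu) + k²n²|u|²) / (1 + |x|)`. Since `n_♯`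
is radial, the factor `n` in the cross term may be replaced by `n - n_♯`, and `|n - n_♯| ≤ ε n` with
`ε < 1`, so the cross term is absorbed by the two squares. What remains bounds `‖u‖_{L²(B_R)}` by a
multiple of `[u]_R` (`exists_coercivity_bound`).

The rest is Hilbert space geometry. Let `v` be the field whose `L²` norm is `[u]_R`; then `∇u` is
recovered from `u` and `v`. The solutions in `B_R`, viewed as pairs `(u, v)`, form a closed set in
`L² × L²` that is stable under midpoints (`isClosed_solLp`, `midpoint_mem_solLp`), and by coercivity
the distance between two of them is controlled by the `v` components alone. The parallelogram law
then makes minimizing sequences Cauchy and minimizers unique.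

For `R → ∞`, put `m(R) = min [·]_R`. Restriction to a smaller ball gives a competitor there, so `m`
is nondecreasing, and `U` itself shows that `m` is bounded by the radiation seminorm of `U`. For `S
≤ T` the parallelogram law in `B_S` gives `[u_T - u_S]_S² ≤ 2(m(T)² - m(S)²)`. Hence the minimizers
converge on every fixed ball. The limits glue to a solution in the whole space with finite radiation
seminorm, which is `U` by the assumed uniqueness. -/

namespace Helmholtz

/-! ### Mollification and weak convergence in `L²` -/

section Mollification

variable {d : ℕ} {X : Type*} [NormedAddCommGroup X] [InnerProductSpace ℂ X]

/-- Correlations of square integrable functions are continuous. -/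
theorem continuous_integral_inner_translate {F G : E d → X} (hF : MemLp F 2 volume)
    (hG : MemLp G 2 volume) :
    Continuous fun s : E d => ∫ x, inner ℂ (G x) (F (s + x)) := by
  -- The correlation is an `L²` inner product with a translate of `F`, and translations act
  -- continuously on `L²`.
  have h : (fun s : E d => ∫ x, inner ℂ (G x) (F (s + x)))
      = fun s : E d => inner ℂ (hG.toLp G) (DomAddAct.mk s +ᵥ hF.toLp F) := by
    funext s
    rw [DomAddAct.mk_vadd_toLp, L2.inner_def]
    refine integral_congr_ae ?_
    filter_upwards [hG.coeFn_toLp,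
      (hF.comp_measurePreserving <| measurePreserving_vadd s volume).coeFn_toLp] with x h1 h2
    exact congrArg₂ (inner ℂ) h1.symm h2.symm
  rw [h]
  have : Fact ((2 : ℝ≥0∞) ≠ ⊤) := ⟨ENNReal.ofNat_ne_top⟩
  have : Continuous fun s : E d => DomAddAct.mk s +ᵥ hF.toLp F :=
    continuous_vadd.comp (f := fun s : E d => (DomAddAct.mk s, hF.toLp F))
      (DomAddAct.continuous_mk.prodMk continuous_const)
  exact continuous_const.inner this

/-- The inequality `|⟨G, F⟩| ≤ |G|² + |F|²` gives an integrable majorant. This licenses the use of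
Fubini when a mollification is paired with `G`. -/
theorem integrable_bump_mul_inner {F G : E d → X} (hF : MemLp F 2 volume)
    (hG : MemLp G 2 volume) (φ : ContDiffBump (0 : E d)) :
    Integrable (fun p : E d × E d =>
      φ.normed volume p.2 • inner ℂ (G p.1) (F (p.1 - p.2))) (volume.prod volume) := by
  have hφ := φ.integrable_normed (μ := (volume : Measure (E d)))
  have h1 : Integrable (fun p : E d × E d => φ.normed volume p.2 * ‖G p.1‖ ^ 2)
      (volume.prod volume) := by
    simpa [mul_comm] using (hG.integrable_norm_pow two_ne_zero).mul_prod hφ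
  have h2 : Integrable (fun p : E d × E d => φ.normed volume p.2 * ‖F (p.1 - p.2)‖ ^ 2)
      (volume.prod volume) :=
    hφ.convolution_integrand (ContinuousLinearMap.mul ℝ ℝ) (hF.integrable_norm_pow two_ne_zero)
  refine (h1.add h2).mono' ?_ (Eventually.of_forall fun p => ?_)
  · have h3 : AEStronglyMeasurable (fun p : E d × E d => φ.normed volume p.2)
        (volume.prod volume) := hφ.aestronglyMeasurable.comp_snd
    exact h3.smul <| hG.1.comp_fst.inner (𝕜 := ℂ) (hF.1.comp_quasiMeasurePreserving
        (quasiMeasurePreserving_sub_of_right_invariant volume volume))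
  · have h := norm_inner_le_norm (𝕜 := ℂ) (G p.1) (F (p.1 - p.2))
    have hn := φ.nonneg_normed (μ := (volume : Measure (E d))) p.2
    rw [norm_smul, Real.norm_of_nonneg hn]
    simp only [Pi.add_apply]
    rw [← mul_add]
    refine mul_le_mul_of_nonneg_left (h.trans ?_) hn
    nlinarith [sq_nonneg (‖G p.1‖ - ‖F (p.1 - p.2)‖), sq_nonneg (‖G p.1‖),
      sq_nonneg (‖F (p.1 - p.2)‖)]

/-- Mollifications of a square integrable function converge to it weakly in `L²`. -/
theorem tendsto_integral_inner_convolution [CompleteSpace X] {F G : E d → X} (hF : MemLp F 2 volume)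
    (hG : MemLp G 2 volume) {ι : Type*} {l : Filter ι} {φ : ι → ContDiffBump (0 : E d)}
    (hφ : Tendsto (fun i => (φ i).rOut) l (𝓝 0)) :
    Tendsto (fun i => ∫ x, inner ℂ (G x)
        (((φ i).normed volume ⋆[ContinuousLinearMap.lsmul ℝ ℝ, volume] F) x)) l
      (𝓝 (∫ x, inner ℂ (G x) (F x))) := by
  -- After Fubini the pairing is the mollification at `0` of the correlation function, which is
  -- continuous, so it tends to the correlation at `0`.
  have h := ContDiffBump.convolution_tendsto_right_of_continuous (μ := (volume : Measure (E d)))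
    hφ (continuous_integral_inner_translate hF hG) 0
  simp only [zero_add] at h
  refine h.congr fun i => ?_
  have hloc : LocallyIntegrable F volume := hF.locallyIntegrable one_le_two
  have e1 : ∀ x, inner ℂ (G x)
        (((φ i).normed volume ⋆[ContinuousLinearMap.lsmul ℝ ℝ, volume] F) x)
      = ∫ t, (φ i).normed volume t • inner ℂ (G x) (F (x - t)) := fun x => by
    have hex : Integrable (fun t => (φ i).normed volume t • F (x - t)) :=
      (φ i).hasCompactSupport_normed.convolutionExists_left (ContinuousLinearMap.lsmul ℝ ℝ)
        (φ i).continuous_normed hloc x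
    rw [convolution_def]
    simp only [ContinuousLinearMap.lsmul_apply]
    rw [← integral_inner hex]
    simp_rw [inner_smul_right_eq_smul]
  simp_rw [e1]
  rw [integral_integral_swap (integrable_bump_mul_inner hF hG (φ i)), convolution_def]
  refine integral_congr_ae (Eventually.of_forall fun t => ?_)
  simp only [ContinuousLinearMap.lsmul_apply]
  rw [integral_smul]
  simp [sub_eq_neg_add]

end Mollification

/-! ### Sesquilinear pairings in `L²` -/

section Pairing

variable {α : Type*} [MeasurableSpace α] {μ : Measure α}
  {X : Type*} [NormedAddCommGroup X] [InnerProductSpace ℂ X]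

theorem integrable_inner_of_memLp {h a : α → X} (hh : MemLp h 2 μ) (ha : MemLp a 2 μ) :
    Integrable (fun x => inner ℂ (h x) (a x)) μ := by
  refine (hh.norm.integrable_mul ha.norm).mono' (hh.1.inner ha.1)
    (Eventually.of_forall fun x => norm_inner_le_norm _ _)

theorem integral_inner_combo {h a b : α → X} (hh : MemLp h 2 μ) (ha : MemLp a 2 μ)
    (hb : MemLp b 2 μ) (s t : ℂ) :
    ∫ x, inner ℂ (h x) (s • a x + t • b x) ∂μ
      = s * ∫ x, inner ℂ (h x) (a x) ∂μ + t * ∫ x, inner ℂ (h x) (b x) ∂μ := by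
  simp_rw [inner_add_right, inner_smul_right]
  rw [integral_add ((integrable_inner_of_memLp hh ha).const_mul s)
    ((integrable_inner_of_memLp hh hb).const_mul t), integral_const_mul, integral_const_mul]

theorem continuous_integral_inner_Lp {h : α → X} (hh : MemLp h 2 μ) :
    Continuous fun a : Lp X 2 μ => ∫ x, inner ℂ (h x) (a x) ∂μ := by
  have e : (fun a : Lp X 2 μ => ∫ x, inner ℂ (h x) (a x) ∂μ)
      = fun a => inner ℂ (hh.toLp h) a := by
    funext a
    rw [L2.inner_def]
    refine integral_congr_ae ?_
    filter_upwards [hh.coeFn_toLp] with x hx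
    rw [hx]
  rw [e]
  exact continuous_const.inner continuous_id

theorem memLp_top_smul {h : α → ℂ} {a : α → X} (hh : MemLp h ⊤ μ) (ha : MemLp a 2 μ) :
    MemLp (fun x => h x • a x) 2 μ :=
  MemLp.smul (𝕜 := ℂ) ha hh

end Pairing

/-! ### Weak gradients -/

section WeakGradient

variable {d : ℕ} {Ω Ω' : Set (E d)} {u v : E d → ℂ} {g h : E d → V d}

theorem setIntegral_eq_of_tsupport_subset {X : Type*} [NormedAddCommGroup X] [NormedSpace ℝ X]
    {F : E d → X} (hΩ : Ω' ⊆ Ω) (hF : ∀ x ∉ Ω', F x = 0) :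
    ∫ x in Ω, F x = ∫ x in Ω', F x := by
  rw [setIntegral_eq_integral_of_forall_compl_eq_zero hF,
    setIntegral_eq_integral_of_forall_compl_eq_zero fun x hx => hF x fun h => hx (hΩ h)]

theorem fderiv_eq_zero_of_notMem {φ : E d → ℂ} (hφ : tsupport φ ⊆ Ω) {x : E d} (hx : x ∉ Ω) :
    fderiv ℝ φ x = 0 :=
  image_eq_zero_of_notMem_tsupport fun h => hx (hφ (tsupport_fderiv_subset ℝ h))

theorem eq_zero_of_notMem {Y : Type*} [Zero Y] {φ : E d → Y} (hφ : tsupport φ ⊆ Ω) {x : E d}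
    (hx : x ∉ Ω) : φ x = 0 :=
  image_eq_zero_of_notMem_tsupport fun h => hx (hφ h)

theorem grad_eq_zero_of_notMem {φ : E d → ℂ} (hφ : tsupport φ ⊆ Ω) {x : E d} (hx : x ∉ Ω) :
    grad φ x = 0 := by
  ext i
  simp [grad, fderiv_eq_zero_of_notMem hφ hx]

theorem HasWeakGradOn.mono (hu : HasWeakGradOn Ω u g) (hΩ : Ω' ⊆ Ω) : HasWeakGradOn Ω' u g := by
  refine ⟨hu.1.mono_set hΩ, hu.2.1.mono_set hΩ, fun φ h1 h2 h3 i => ?_⟩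
  have h := hu.2.2 φ h1 h2 (h3.trans hΩ) i
  rwa [setIntegral_eq_of_tsupport_subset hΩ fun x hx => ?_,
    setIntegral_eq_of_tsupport_subset hΩ fun x hx => ?_] at h
  · simp [eq_zero_of_notMem h3 hx]
  · have : fderiv ℝ φ x = 0 :=
      image_eq_zero_of_notMem_tsupport fun h => hx (h3 (tsupport_fderiv_subset ℝ h))
    simp [this]

theorem integrable_smul_of_locallyIntegrableOn {X : Type*} [NormedAddCommGroup X]
    [NormedSpace ℝ X] {a : E d → X} (ha : LocallyIntegrableOn a Ω volume) {φ : E d → ℝ}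
    (hφ : Continuous φ) (hc : HasCompactSupport φ) (hs : tsupport φ ⊆ Ω) :
    Integrable (fun x => φ x • a x) volume := by
  have h1 : IntegrableOn a (tsupport φ) volume :=
    (ha.mono_set hs).integrableOn_isCompact hc
  rw [← integrableOn_iff_integrable_of_support_subset (s := tsupport φ)]
  · exact h1.continuousOn_smul hφ.continuousOn hc
  · exact fun x hx => subset_tsupport φ fun h => hx (by simp [h])

/-- The fundamental lemma of the calculus of variations, applied to each component of `g - h`. It
frees later arguments from the particular gradient chosen by `weakGrad`. -/
theorem HasWeakGradOn.ae_eq (hΩ : IsOpen Ω) (hg : HasWeakGradOn Ω u g)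
    (hh : HasWeakGradOn Ω u h) : g =ᵐ[volume.restrict Ω] h := by
  have key : ∀ i : Fin d, ∀ᵐ x, x ∈ Ω → (g x - h x) i = 0 := fun i => by
    have hloc : ∀ {b : E d → V d}, LocallyIntegrableOn b Ω volume →
        LocallyIntegrableOn (fun x => b x i) Ω volume := fun hb x hx => by
      obtain ⟨s, hs, hi⟩ := hb x hx
      exact ⟨s, hs, (EuclideanSpace.proj (𝕜 := ℂ) i).integrable_comp hi⟩
    refine hΩ.ae_eq_zero_of_integral_contDiff_smul_eq_zero
      ((hloc hg.2.1).sub (hloc hh.2.1)) fun φ h1 h2 h3 => ?_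
    have e1 := hg.2.2 φ h1 h2 h3 i
    have e2 := hh.2.2 φ h1 h2 h3 i
    rw [e1, neg_inj, setIntegral_eq_integral_of_forall_compl_eq_zero fun x hx => ?_,
      setIntegral_eq_integral_of_forall_compl_eq_zero fun x hx => ?_] at e2
    · have e3 : ∀ x, φ x • ((fun x => g x i) - fun x => h x i) x
          = φ x • g x i - φ x • h x i := fun x => by simp [smul_sub]
      simp only [PiLp.sub_apply]
      change ∫ x, φ x • (((fun x => g x i) - fun x => h x i) x) = 0
      simp_rw [e3]
      rw [integral_sub (integrable_smul_of_locallyIntegrableOn (hloc hg.2.1) h1.continuous h2 h3)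
        (integrable_smul_of_locallyIntegrableOn (hloc hh.2.1) h1.continuous h2 h3), sub_eq_zero]
      simpa [Complex.real_smul] using e2
    · simp [eq_zero_of_notMem h3 hx]
    · simp [eq_zero_of_notMem h3 hx]
  rw [EventuallyEq, ae_restrict_iff' hΩ.measurableSet]
  filter_upwards [ae_all_iff.2 key] with x hx hxΩ
  ext i
  simpa [sub_eq_zero] using hx i hxΩ

theorem HasWeakGradOn.weakGrad (hg : HasWeakGradOn Ω u g) :
    HasWeakGradOn Ω u (weakGrad Ω u) := by
  have h : ∃ g, HasWeakGradOn Ω u g := ⟨g, hg⟩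
  rw [Helmholtz.weakGrad, dif_pos h]
  exact h.choose_spec

theorem HasWeakGradOn.weakGrad_ae_eq (hΩ : IsOpen Ω) (hg : HasWeakGradOn Ω u g) :
    Helmholtz.weakGrad Ω u =ᵐ[volume.restrict Ω] g :=
  hg.weakGrad.ae_eq hΩ hg

/-- `u` and `g` are square integrable in `Ω`, and `g` is a weak gradient of `u` in `Ω`. -/
structure IsH1Pair {d : ℕ} (Ω : Set (E d)) (u : E d → ℂ) (g : E d → V d) : Prop where
  memLp : MemLp u 2 (volume.restrict Ω)
  memLp_grad : MemLp g 2 (volume.restrict Ω)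
  integral_eq : ∀ φ : E d → ℝ, ContDiff ℝ ∞ φ → HasCompactSupport φ → tsupport φ ⊆ Ω →
    ∀ i : Fin d, ∫ x in Ω, ((fderiv ℝ φ x (EuclideanSpace.single i 1) : ℝ) : ℂ) * u x
        = - ∫ x in Ω, (φ x : ℂ) * g x i

theorem IsH1Pair.hasWeakGradOn (hu : IsH1Pair Ω u g) : HasWeakGradOn Ω u g :=
  ⟨locallyIntegrableOn_of_locallyIntegrable_restrict (hu.memLp.locallyIntegrable one_le_two),
    locallyIntegrableOn_of_locallyIntegrable_restrict (hu.memLp_grad.locallyIntegrable one_le_two),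
    hu.integral_eq⟩

theorem IsH1Pair.memH1 (hu : IsH1Pair Ω u g) : MemH1 Ω u :=
  ⟨hu.memLp, g, hu.hasWeakGradOn, hu.memLp_grad⟩

theorem MemH1.isH1Pair (hΩ : IsOpen Ω) (hu : MemH1 Ω u) : IsH1Pair Ω u (weakGrad Ω u) := by
  obtain ⟨h1, g, h2, h3⟩ := hu
  exact ⟨h1, h3.ae_eq (h2.weakGrad_ae_eq hΩ).symm, h2.weakGrad.2.2⟩

theorem IsH1Pair.congr (hu : IsH1Pair Ω u g) (h1 : u =ᵐ[volume.restrict Ω] v)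
    (h2 : g =ᵐ[volume.restrict Ω] h) : IsH1Pair Ω v h := by
  refine ⟨hu.memLp.ae_eq h1, hu.memLp_grad.ae_eq h2, fun φ a b c i => ?_⟩
  convert hu.integral_eq φ a b c i using 1
  · refine integral_congr_ae ?_
    filter_upwards [h1] with x hx
    rw [hx]
  · congr 1
    refine integral_congr_ae ?_
    filter_upwards [h2] with x hx
    rw [hx]

theorem IsH1Pair.mono (hu : IsH1Pair Ω u g) (hΩ : Ω' ⊆ Ω) : IsH1Pair Ω' u g :=
  ⟨hu.memLp.mono_measure (Measure.restrict_mono_set _ hΩ),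
    hu.memLp_grad.mono_measure (Measure.restrict_mono_set _ hΩ),
    (hu.hasWeakGradOn.mono hΩ).2.2⟩

theorem memLp_of_continuous {Y : Type*} [NormedAddCommGroup Y] {φ : E d → Y}
    (hφ : Continuous φ) (hc : HasCompactSupport φ) (p : ℝ≥0∞) :
    MemLp φ p (volume.restrict Ω) :=
  (hφ.memLp_of_hasCompactSupport hc).restrict Ω

theorem continuous_fderiv_single {φ : E d → ℝ} (h1 : ContDiff ℝ ∞ φ) (i : Fin d) :
    Continuous fun x => ((fderiv ℝ φ x (EuclideanSpace.single i 1) : ℝ) : ℂ) :=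
  Complex.continuous_ofReal.comp
    ((h1.continuous_fderiv (by simp)).clm_apply continuous_const)

theorem memLp_fderiv_single {φ : E d → ℝ} (h1 : ContDiff ℝ ∞ φ) (h2 : HasCompactSupport φ)
    (i : Fin d) :
    MemLp (fun x => ((fderiv ℝ φ x (EuclideanSpace.single i 1) : ℝ) : ℂ)) 2
      (volume.restrict Ω) :=
  memLp_of_continuous (continuous_fderiv_single h1 i)
    ((h2.fderiv ℝ).comp_left
      (g := fun L : E d →L[ℝ] ℝ => ((L (EuclideanSpace.single i 1) : ℝ) : ℂ)) (by simp)) 2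

theorem memLp_smul_single {φ : E d → ℝ} (h1 : ContDiff ℝ ∞ φ) (h2 : HasCompactSupport φ)
    (i : Fin d) :
    MemLp (fun x => (φ x : ℂ) • (EuclideanSpace.single i 1 : V d)) 2 (volume.restrict Ω) :=
  memLp_of_continuous ((Complex.continuous_ofReal.comp h1.continuous).smul continuous_const)
    (h2.comp_left (g := fun t : ℝ => (t : ℂ) • (EuclideanSpace.single i 1 : V d)) (by simp)) 2

/-- This and its companions put every integral of the weak formulation in the form of an `L²` inner
product, so that linearity and continuity in the solution come from general facts. -/
theorem ofReal_mul_eq_inner (s : ℝ) (z : ℂ) : (s : ℂ) * z = inner ℂ (s : ℂ) z := by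
  simp [mul_comm]

theorem ofReal_mul_apply_eq_inner (s : ℝ) (z : V d) (i : Fin d) :
    (s : ℂ) * z i = inner ℂ ((s : ℂ) • (EuclideanSpace.single i 1 : V d)) z := by
  simp [EuclideanSpace.inner_single_left]

theorem IsH1Pair.combo (hu : IsH1Pair Ω u g) (hv : IsH1Pair Ω v h) (s t : ℂ) :
    IsH1Pair Ω (fun x => s • u x + t • v x) (fun x => s • g x + t • h x) := by
  refine ⟨(hu.memLp.const_smul s).add (hv.memLp.const_smul t),
    (hu.memLp_grad.const_smul s).add (hv.memLp_grad.const_smul t), fun φ a b c i => ?_⟩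
  have e1 := hu.integral_eq φ a b c i
  have e2 := hv.integral_eq φ a b c i
  simp_rw [ofReal_mul_eq_inner _ (u _), ofReal_mul_apply_eq_inner] at e1
  simp_rw [ofReal_mul_eq_inner _ (v _), ofReal_mul_apply_eq_inner] at e2
  simp_rw [ofReal_mul_eq_inner _ (s • u _ + t • v _), ofReal_mul_apply_eq_inner]
  rw [integral_inner_combo (memLp_fderiv_single a b i) hu.memLp hv.memLp,
    integral_inner_combo (memLp_smul_single a b i) hu.memLp_grad hv.memLp_grad, e1, e2]
  ring

end WeakGradient

/-! ### Weak solutions with explicit gradients -/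

section WeakForm

variable {d : ℕ} {Ω Ω' : Set (E d)} {u v : E d → ℂ} {g h : E d → V d} {k : ℝ} {n : E d → ℝ}
  {F G : (E d → ℂ) → ℂ}

/-- The left-hand side of the variational formulation of `Δu + k² n² u = f`, with an explicit
gradient. -/
noncomputable def weakForm {d : ℕ} (k : ℝ) (n : E d → ℝ) (Ω : Set (E d)) (φ u : E d → ℂ)
    (g : E d → V d) : ℂ :=
  -(∫ x in Ω, inner ℂ (grad φ x) (g x))
    + (k : ℂ) ^ 2 * ∫ x in Ω, (n x : ℂ) ^ 2 * u x * starRingEnd ℂ (φ x)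

/-- `u`, with weak gradient `g`, is an `H¹` solution in `Ω` of the variational problem with
right-hand side `F`. -/
structure IsSolPair {d : ℕ} (k : ℝ) (n : E d → ℝ) (F : (E d → ℂ) → ℂ) (Ω : Set (E d))
    (u : E d → ℂ) (g : E d → V d) : Prop extends IsH1Pair Ω u g where
  weakForm_eq : ∀ φ : E d → ℂ, ContDiff ℝ 1 φ → HasCompactSupport φ → tsupport φ ⊆ Ω →
    weakForm k n Ω φ u g = F φ

theorem continuous_grad {φ : E d → ℂ} (h1 : ContDiff ℝ 1 φ) : Continuous (grad φ) := by
  refine (PiLp.continuous_toLp 2 _).comp (continuous_pi fun i => ?_)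
  exact (h1.continuous_fderiv one_ne_zero).clm_apply continuous_const

theorem hasCompactSupport_grad {φ : E d → ℂ} (h2 : HasCompactSupport φ) :
    HasCompactSupport (grad φ) :=
  (h2.fderiv ℝ).comp_left
    (g := fun L : E d →L[ℝ] ℂ =>
      (WithLp.toLp 2 fun i => L (EuclideanSpace.single i 1) : V d)) (by ext i; simp)

theorem memLp_grad {φ : E d → ℂ} (h1 : ContDiff ℝ 1 φ) (h2 : HasCompactSupport φ) :
    MemLp (grad φ) 2 (volume.restrict Ω) :=
  memLp_of_continuous (continuous_grad h1) (hasCompactSupport_grad h2) 2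

theorem memLp_ofReal_top (hn : MemLp n ⊤ volume) :
    MemLp (fun x => (n x : ℂ)) ⊤ (volume.restrict Ω) :=
  (hn.restrict Ω).ofReal

theorem memLp_sq_mul (hn : MemLp n ⊤ volume) {φ : E d → ℂ}
    (hφ : MemLp φ 2 (volume.restrict Ω)) :
    MemLp (fun x => (n x : ℂ) ^ 2 * φ x) 2 (volume.restrict Ω) := by
  have h := memLp_top_smul (memLp_ofReal_top hn) (memLp_top_smul (memLp_ofReal_top hn) hφ)
  simpa [pow_two, mul_assoc] using h

theorem sq_mul_mul_conj_eq_inner (s : ℝ) (z w : ℂ) :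
    (s : ℂ) ^ 2 * z * starRingEnd ℂ w = inner ℂ ((s : ℂ) ^ 2 * w) z := by
  simp; ring

theorem weakForm_combo (hn : MemLp n ⊤ volume) (hu : IsH1Pair Ω u g) (hv : IsH1Pair Ω v h)
    (s t : ℂ) {φ : E d → ℂ} (h1 : ContDiff ℝ 1 φ) (h2 : HasCompactSupport φ) :
    weakForm k n Ω φ (fun x => s • u x + t • v x) (fun x => s • g x + t • h x)
      = s * weakForm k n Ω φ u g + t * weakForm k n Ω φ v h := by
  simp only [weakForm]
  simp_rw [sq_mul_mul_conj_eq_inner]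
  rw [integral_inner_combo (memLp_grad h1 h2) hu.memLp_grad hv.memLp_grad,
    integral_inner_combo (memLp_sq_mul hn (memLp_of_continuous h1.continuous h2 2))
      hu.memLp hv.memLp]
  ring

/-- An arbitrary functional on the right covers the two cases needed later: differences of solutions
solve the homogeneous problem, and midpoints solve the original one. -/
theorem IsSolPair.combo (hn : MemLp n ⊤ volume) (hu : IsSolPair k n F Ω u g)
    (hv : IsSolPair k n G Ω v h) (s t : ℂ) :
    IsSolPair k n (fun φ => s * F φ + t * G φ) Ω (fun x => s • u x + t • v x)
      (fun x => s • g x + t • h x) :=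
  ⟨hu.toIsH1Pair.combo hv.toIsH1Pair s t, fun φ a b c => by
    rw [weakForm_combo hn hu.toIsH1Pair hv.toIsH1Pair s t a b, hu.weakForm_eq φ a b c,
      hv.weakForm_eq φ a b c]⟩

theorem weakForm_congr {φ : E d → ℂ} (h1 : u =ᵐ[volume.restrict Ω] v)
    (h2 : g =ᵐ[volume.restrict Ω] h) : weakForm k n Ω φ u g = weakForm k n Ω φ v h := by
  simp only [weakForm]
  congr 2
  · refine integral_congr_ae ?_
    filter_upwards [h2] with x hx
    rw [hx]
  · refine integral_congr_ae ?_
    filter_upwards [h1] with x hx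
    rw [hx]

theorem IsSolPair.congr (hu : IsSolPair k n F Ω u g) (h1 : u =ᵐ[volume.restrict Ω] v)
    (h2 : g =ᵐ[volume.restrict Ω] h) : IsSolPair k n F Ω v h :=
  ⟨hu.toIsH1Pair.congr h1 h2, fun φ a b c => by
    rw [← weakForm_congr h1 h2, hu.weakForm_eq φ a b c]⟩

theorem weakForm_mono (hΩ : Ω' ⊆ Ω) {φ : E d → ℂ} (hs : tsupport φ ⊆ Ω') :
    weakForm k n Ω φ u g = weakForm k n Ω' φ u g := by
  simp only [weakForm]
  rw [setIntegral_eq_of_tsupport_subset hΩ fun x hx => ?_,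
    setIntegral_eq_of_tsupport_subset hΩ fun x hx => ?_]
  · simp [eq_zero_of_notMem hs hx]
  · simp [grad_eq_zero_of_notMem hs hx]

theorem IsSolPair.mono (hu : IsSolPair k n F Ω u g) (hΩ : Ω' ⊆ Ω) : IsSolPair k n F Ω' u g :=
  ⟨hu.toIsH1Pair.mono hΩ, fun φ a b c => by
    rw [← weakForm_mono hΩ c, hu.weakForm_eq φ a b (c.trans hΩ)]⟩

/-- The right-hand side of the variational formulation of `Δu + k² n² u = f`. -/
noncomputable def rhs {d : ℕ} (f : E d → ℂ) (φ : E d → ℂ) : ℂ :=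
  ∫ x, f x * starRingEnd ℂ (φ x)

theorem setIntegral_mul_conj_eq_rhs (f : E d → ℂ) {φ : E d → ℂ} (hs : tsupport φ ⊆ Ω) :
    ∫ x in Ω, f x * starRingEnd ℂ (φ x) = rhs f φ :=
  setIntegral_eq_integral_of_forall_compl_eq_zero fun x hx => by
    simp [eq_zero_of_notMem hs hx]

theorem IsSolPair.isWeakSolution {f : E d → ℂ} (hΩ : IsOpen Ω)
    (hu : IsSolPair k n (rhs f) Ω u g) : IsWeakSolution k n f Ω u := fun φ a b c => by
  rw [setIntegral_mul_conj_eq_rhs f c, ← hu.weakForm_eq φ a b c]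
  exact weakForm_congr (EventuallyEq.refl _ _) (hu.hasWeakGradOn.weakGrad_ae_eq hΩ)

theorem IsWeakSolution.isSolPair {f : E d → ℂ} (hu : IsWeakSolution k n f Ω u)
    (h : IsH1Pair Ω u (weakGrad Ω u)) : IsSolPair k n (rhs f) Ω u (weakGrad Ω u) :=
  ⟨h, fun φ a b c => by
    rw [← setIntegral_mul_conj_eq_rhs f c]
    exact hu φ a b c⟩

theorem mem_solutionSet_iff {f : E d → ℂ} {R : ℝ} :
    u ∈ solutionSet k n f R ↔ ∃ g, IsSolPair k n (rhs f) (ball 0 R) u g :=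
  ⟨fun h => ⟨_, h.2.isSolPair (h.1.isH1Pair isOpen_ball)⟩,
    fun ⟨_, h⟩ => ⟨h.memH1, h.isWeakSolution isOpen_ball⟩⟩

end WeakForm

/-! ### Testing a homogeneous equation with a multiple of its solution -/

section Test

variable {d : ℕ} {Ω : Set (E d)} {u : E d → ℂ} {g : E d → V d} {k : ℝ} {n : E d → ℝ}

theorem integral_inner_indicator {X : Type*} [NormedAddCommGroup X] [InnerProductSpace ℂ X]
    (hΩ : MeasurableSet Ω) (G H : E d → X) :
    ∫ x, inner ℂ (Ω.indicator G x) (H x) = ∫ x in Ω, inner ℂ (G x) (H x) := by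
  rw [← integral_indicator hΩ]
  refine integral_congr_ae (Eventually.of_forall fun x => ?_)
  by_cases hx : x ∈ Ω <;> simp [hx]

theorem tendsto_setIntegral_inner_convolution {X : Type*} [NormedAddCommGroup X]
    [InnerProductSpace ℂ X] [CompleteSpace X] (hΩ : MeasurableSet Ω) {F G : E d → X}
    (hF : MemLp F 2 (volume.restrict Ω)) (hG : MemLp G 2 (volume.restrict Ω)) {ι : Type*}
    {l : Filter ι} {φ : ι → ContDiffBump (0 : E d)}
    (hφ : Tendsto (fun i => (φ i).rOut) l (𝓝 0)) :
    Tendsto (fun i => ∫ x in Ω, inner ℂ (G x)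
        (((φ i).normed volume ⋆[ContinuousLinearMap.lsmul ℝ ℝ, volume] Ω.indicator F) x)) l
      (𝓝 (∫ x in Ω, inner ℂ (G x) (F x))) := by
  have hF' : MemLp (Ω.indicator F) 2 volume := (memLp_indicator_iff_restrict hΩ).2 hF
  have hG' : MemLp (Ω.indicator G) 2 volume := (memLp_indicator_iff_restrict hΩ).2 hG
  have h := tendsto_integral_inner_convolution hF' hG' hφ
  rw [integral_inner_indicator hΩ] at h
  have e : ∫ x in Ω, inner ℂ (G x) (Ω.indicator F x) = ∫ x in Ω, inner ℂ (G x) (F x) :=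
    setIntegral_congr_fun hΩ fun x hx => by simp only [Set.indicator_of_mem hx]
  rw [e] at h
  exact h.congr fun i => integral_inner_indicator hΩ _ _

/-- Inside `Ω`, the gradient of a mollified function is the mollified weak gradient. -/
theorem IsH1Pair.grad_convolution (hΩ : MeasurableSet Ω) (hu : IsH1Pair Ω u g)
    (φ : ContDiffBump (0 : E d)) {x : E d} (hx : closedBall x φ.rOut ⊆ Ω) :
    grad (φ.normed volume ⋆[ContinuousLinearMap.lsmul ℝ ℝ, volume] Ω.indicator u) x
      = (φ.normed volume ⋆[ContinuousLinearMap.lsmul ℝ ℝ, volume] Ω.indicator g) x := by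
  set ρ := φ.normed (volume : Measure (E d)) with hρ
  have hρs : ContDiff ℝ ∞ ρ := φ.contDiff_normed (n := ⊤)
  have hρc : HasCompactSupport ρ := φ.hasCompactSupport_normed
  have hul : LocallyIntegrable (Ω.indicator u) volume :=
    ((memLp_indicator_iff_restrict hΩ).2 hu.memLp).locallyIntegrable one_le_two
  have hgl : LocallyIntegrable (Ω.indicator g) volume :=
    ((memLp_indicator_iff_restrict hΩ).2 hu.memLp_grad).locallyIntegrable one_le_two
  have hd := hρc.hasFDerivAt_convolution_left (ContinuousLinearMap.lsmul ℝ ℝ) (hρs.of_le (by simp))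
    hul x
  ext i
  simp only [grad, hd.fderiv]
  have hex : ConvolutionExistsAt (fderiv ℝ ρ) (Ω.indicator u) x
      ((ContinuousLinearMap.lsmul ℝ ℝ : ℝ →L[ℝ] ℂ →L[ℝ] ℂ).precompL (E d)) volume :=
    (hρc.fderiv ℝ).convolutionExists_left _ (hρs.continuous_fderiv (by simp)) hul x
  have e1 : ((fderiv ℝ ρ ⋆[(ContinuousLinearMap.lsmul ℝ ℝ : ℝ →L[ℝ] ℂ →L[ℝ] ℂ).precompL (E d),
      volume] Ω.indicator u) x) (EuclideanSpace.single i 1)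
      = ∫ y, (fderiv ℝ ρ (x - y) (EuclideanSpace.single i 1)) • Ω.indicator u y := by
    rw [convolution_def, ContinuousLinearMap.integral_apply hex.integrable]
    rw [← integral_sub_left_eq_self _ volume x]
    simp [ContinuousLinearMap.precompL_apply]
  have hg2 : Integrable (fun t => ρ t • Ω.indicator g (x - t)) :=
    hρc.convolutionExists_left (ContinuousLinearMap.lsmul ℝ ℝ) hρs.continuous hgl x
  have e2 : ((ρ ⋆[ContinuousLinearMap.lsmul ℝ ℝ, volume] Ω.indicator g) x) i
      = ∫ y, ρ (x - y) • Ω.indicator g y i := by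
    rw [convolution_def]
    simp only [ContinuousLinearMap.lsmul_apply]
    have := (EuclideanSpace.proj (𝕜 := ℂ) i : V d →L[ℂ] ℂ).integral_comp_comm hg2
    refine this.symm.trans ?_
    rw [← integral_sub_left_eq_self _ volume x]
    simp
  rw [e1, e2]
  have hts : tsupport (fun y => ρ (x - y)) ⊆ closedBall x φ.rOut := by
    refine closure_minimal (fun y hy => ?_) isClosed_closedBall
    have h1 : x - y ∈ Function.support ρ := hy
    rw [hρ, φ.support_normed_eq, mem_ball_zero_iff] at h1
    rw [mem_closedBall, dist_comm, dist_eq_norm]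
    exact h1.le
  -- The reflected kernel is itself a smooth test function supported in `Ω`; the minus sign from
  -- differentiating `x - y` cancels the one in the definition of the weak gradient.
  have key := hu.integral_eq (fun y => ρ (x - y)) (hρs.comp (contDiff_const.sub contDiff_id))
    (HasCompactSupport.intro (isCompact_closedBall x φ.rOut)
      fun y hy => eq_zero_of_notMem hts hy) (hts.trans hx) i
  have hfd : ∀ y, fderiv ℝ (fun y => ρ (x - y)) y (EuclideanSpace.single i 1)
      = - fderiv ℝ ρ (x - y) (EuclideanSpace.single i 1) := fun y => by
    have h1 : HasFDerivAt ρ (fderiv ℝ ρ (x - y)) (x - y) :=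
      ((hρs.differentiable (by simp)) _).hasFDerivAt
    have h2 : HasFDerivAt (fun y => x - y) (-ContinuousLinearMap.id ℝ (E d)) y :=
      (hasFDerivAt_id y).const_sub x
    have h3 : HasFDerivAt (fun y => ρ (x - y)) _ y := h1.comp y h2
    rw [h3.fderiv]
    simp
  simp_rw [hfd] at key
  rw [← integral_indicator hΩ, ← integral_indicator hΩ, ← integral_neg] at key
  rw [← neg_inj, ← integral_neg, ← integral_neg]
  convert key using 1
  · refine integral_congr_ae (Eventually.of_forall fun y => ?_)
    by_cases hy : y ∈ Ω <;> simp [hy]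
  · refine integral_congr_ae (Eventually.of_forall fun y => ?_)
    by_cases hy : y ∈ Ω <;> simp [hy]

theorem grad_mul {ψ : E d → ℝ} {φ : E d → ℂ} (hψ : Differentiable ℝ ψ) (hφ : Differentiable ℝ φ)
    (x : E d) :
    grad (fun x => (ψ x : ℂ) * φ x) x
      = (ψ x : ℂ) • grad φ x + φ x • grad (fun x => (ψ x : ℂ)) x := by
  have h1 : HasFDerivAt (fun x => (ψ x : ℂ)) (Complex.ofRealCLM.comp (fderiv ℝ ψ x)) x :=
    Complex.ofRealCLM.hasFDerivAt.comp x (hψ x).hasFDerivAt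
  ext i
  simp only [grad]
  have h2 : HasFDerivAt (fun x => (ψ x : ℂ) * φ x) _ x := h1.mul (hφ x).hasFDerivAt
  rw [h2.fderiv, h1.fderiv]
  simp

theorem exists_contDiffBump_tendsto {δ : ℝ} (hδ : 0 < δ) :
    ∃ φ : ℕ → ContDiffBump (0 : E d), (∀ j, (φ j).rOut ≤ δ) ∧
      Tendsto (fun j => (φ j).rOut) atTop (𝓝 0) := by
  have h : ∀ j : ℕ, 0 < δ / ((j : ℝ) + 2) := fun j => by positivity
  refine ⟨fun j => ⟨δ / ((j : ℝ) + 2) / 2, δ / ((j : ℝ) + 2), half_pos (h j),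
    half_lt_self (h j)⟩, fun j => ?_, ?_⟩
  · refine div_le_self hδ.le ?_
    have : (0 : ℝ) ≤ j := j.cast_nonneg
    linarith
  · exact (tendsto_const_nhds (x := δ)).div_atTop
      (tendsto_atTop_add_const_right _ _ tendsto_natCast_atTop_atTop)

/-- A homogeneous solution `u` has no energy flux through the level sets of `ψ`, on average. -/
theorem IsSolPair.integral_flux_eq_zero (hΩ : IsOpen Ω) (hn : MemLp n ⊤ volume)
    (hu : IsSolPair k n (fun _ => 0) Ω u g) {ψ : E d → ℝ} (h1 : ContDiff ℝ 1 ψ)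
    (h2 : HasCompactSupport ψ) (h3 : tsupport ψ ⊆ Ω) :
    (∫ x in Ω, inner ℂ (u x) (inner ℂ (grad (fun x => (ψ x : ℂ)) x) (g x) : ℂ)).im = 0 := by
  have hψc : ContDiff ℝ 1 fun x => (ψ x : ℂ) := Complex.ofRealCLM.contDiff.comp h1
  have hψs : HasCompactSupport fun x => (ψ x : ℂ) := 
    h2.comp_left (g := fun t : ℝ => (t : ℂ)) Complex.ofReal_zero
  -- Mollifying at radius at most `δ` keeps the formula for the gradient valid on all of `tsupport
  -- ψ`.
  obtain ⟨δ, hδ, hK⟩ := h2.isCompact.exists_cthickening_subset_open hΩ h3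
  obtain ⟨φ, hφδ, hφ⟩ := exists_contDiffBump_tendsto (d := d) hδ
  have hm := hΩ.measurableSet
  have hul : LocallyIntegrable (Ω.indicator u) volume :=
    ((memLp_indicator_iff_restrict hm).2 hu.memLp).locallyIntegrable one_le_two
  -- Test functions must be `C¹`, so `ψ u` is not admissible. It is replaced by `ψ w_j` with `w_j` a
  -- mollification of `u`; weak `L²` convergence suffices for the limit.
  obtain ⟨w, hw⟩ : ∃ w : ℕ → E d → ℂ, w = fun j =>
    (φ j).normed volume ⋆[ContinuousLinearMap.lsmul ℝ ℝ, volume] Ω.indicator u := ⟨_, rfl⟩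
  obtain ⟨q, hq⟩ : ∃ q : ℕ → E d → V d, q = fun j =>
    (φ j).normed volume ⋆[ContinuousLinearMap.lsmul ℝ ℝ, volume] Ω.indicator g := ⟨_, rfl⟩
  have hwc : ∀ j, ContDiff ℝ 1 (w j) := fun j => by
    rw [hw]
    exact (φ j).hasCompactSupport_normed.contDiff_convolution_left _
      ((φ j).contDiff_normed (n := 1)) hul
  have hgrad : ∀ j x, grad (fun x => (ψ x : ℂ) * w j x) x
      = (ψ x : ℂ) • q j x + w j x • grad (fun x => (ψ x : ℂ)) x := fun j x => by
    rw [grad_mul (h1.differentiable one_ne_zero) ((hwc j).differentiable one_ne_zero)]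
    by_cases hx : x ∈ tsupport ψ
    · rw [hw, hq, hu.toIsH1Pair.grad_convolution hm (φ j)
        ((closedBall_subset_closedBall (hφδ j)).trans
          ((closedBall_subset_cthickening hx δ).trans hK))]
    · simp [image_eq_zero_of_notMem_tsupport hx]
  have hψt : MemLp (fun x => (ψ x : ℂ)) ⊤ (volume.restrict Ω) :=
    memLp_of_continuous hψc.continuous hψs ⊤
  have m1 : MemLp (fun x => (ψ x : ℂ) • g x) 2 (volume.restrict Ω) :=
    memLp_top_smul hψt hu.memLp_grad
  have m2 : MemLp (fun x => (inner ℂ (grad (fun x => (ψ x : ℂ)) x) (g x) : ℂ)) 2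
      (volume.restrict Ω) := by
    obtain ⟨C, hC⟩ := (continuous_grad hψc).bounded_above_of_compact_support
      (hasCompactSupport_grad hψs)
    refine hu.memLp_grad.of_le_mul (c := C)
      ((continuous_grad hψc).aestronglyMeasurable.inner hu.memLp_grad.1)
      (Eventually.of_forall fun x => (norm_inner_le_norm _ _).trans ?_)
    gcongr
    exact hC x
  have m3 : MemLp (fun x => (n x : ℂ) ^ 2 * ((ψ x : ℂ) * u x)) 2 (volume.restrict Ω) :=
    memLp_sq_mul hn (memLp_top_smul hψt hu.memLp)
  have T1 : Tendsto (fun j => ∫ x in Ω, inner ℂ ((ψ x : ℂ) • g x) (q j x)) atTop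
      (𝓝 (∫ x in Ω, inner ℂ ((ψ x : ℂ) • g x) (g x))) := by
    rw [hq]
    exact tendsto_setIntegral_inner_convolution hm hu.memLp_grad m1 hφ
  have T2 : Tendsto (fun j => ∫ x in Ω,
        inner ℂ (inner ℂ (grad (fun x => (ψ x : ℂ)) x) (g x) : ℂ) (w j x)) atTop
      (𝓝 (∫ x in Ω, inner ℂ (inner ℂ (grad (fun x => (ψ x : ℂ)) x) (g x) : ℂ) (u x))) := by
    rw [hw]
    exact tendsto_setIntegral_inner_convolution hm hu.memLp m2 hφ
  have T3 : Tendsto (fun j => ∫ x in Ω,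
        inner ℂ ((n x : ℂ) ^ 2 * ((ψ x : ℂ) * u x)) (w j x)) atTop
      (𝓝 (∫ x in Ω, inner ℂ ((n x : ℂ) ^ 2 * ((ψ x : ℂ) * u x)) (u x))) := by
    rw [hw]
    exact tendsto_setIntegral_inner_convolution hm hu.memLp m3 hφ
  -- The equation tested with `ψ w_j` is conjugated, so that the mollified functions stand in the
  -- linear slot of each inner product.
  have hzero : ∀ j, -(∫ x in Ω, inner ℂ ((ψ x : ℂ) • g x) (q j x))
      - (∫ x in Ω, inner ℂ (inner ℂ (grad (fun x => (ψ x : ℂ)) x) (g x) : ℂ) (w j x))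
      + (k : ℂ) ^ 2 * (∫ x in Ω, inner ℂ ((n x : ℂ) ^ 2 * ((ψ x : ℂ) * u x)) (w j x)) = 0 := by
    intro j
    have t1 : ContDiff ℝ 1 fun x => (ψ x : ℂ) * w j x := hψc.mul (hwc j)
    have t2 : HasCompactSupport fun x => (ψ x : ℂ) * w j x := hψs.mul_right
    have t3 : tsupport (fun x => (ψ x : ℂ) * w j x) ⊆ Ω :=
      (closure_mono fun x (hx : (ψ x : ℂ) * w j x ≠ 0) (h : ψ x = 0) =>
        hx (by simp [h])).trans h3
    have e := congrArg (starRingEnd ℂ) (hu.weakForm_eq _ t1 t2 t3)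
    simp only [weakForm, map_add, map_neg, map_mul, map_pow, Complex.conj_ofReal,
      ← integral_conj, inner_conj_symm, map_zero, Complex.conj_conj] at e
    have i1 : Integrable (fun x => inner ℂ (g x) (grad (fun x => (ψ x : ℂ) * w j x) x))
        (volume.restrict Ω) := integrable_inner_of_memLp hu.memLp_grad (memLp_grad t1 t2)
    have m4 : MemLp (fun x => w j x • grad (fun x => (ψ x : ℂ)) x) 2 (volume.restrict Ω) :=
      memLp_of_continuous ((hwc j).continuous.smul (continuous_grad hψc))
        (hasCompactSupport_grad hψs).smul_left 2
    have i2 := integrable_inner_of_memLp hu.memLp_grad m4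
    have e1 : ∫ x in Ω, inner ℂ (g x) (grad (fun x => (ψ x : ℂ) * w j x) x)
        = (∫ x in Ω, inner ℂ ((ψ x : ℂ) • g x) (q j x))
          + ∫ x in Ω, inner ℂ (inner ℂ (grad (fun x => (ψ x : ℂ)) x) (g x) : ℂ) (w j x) := by
      have e2 : ∀ x, inner ℂ (inner ℂ (grad (fun x => (ψ x : ℂ)) x) (g x) : ℂ) (w j x)
          = inner ℂ (g x) (w j x • grad (fun x => (ψ x : ℂ)) x) := fun x => by
        rw [inner_smul_right, RCLike.inner_apply, inner_conj_symm]
      have e3 : ∀ x, inner ℂ ((ψ x : ℂ) • g x) (q j x)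
          = inner ℂ (g x) (grad (fun x => (ψ x : ℂ) * w j x) x)
            - inner ℂ (g x) (w j x • grad (fun x => (ψ x : ℂ)) x) := fun x => by
        rw [hgrad, inner_add_right, add_sub_cancel_right, inner_smul_left, inner_smul_right,
          Complex.conj_ofReal]
      simp_rw [e2, e3]
      rw [integral_sub i1 i2, sub_add_cancel]
    rw [e1] at e
    have e4 : ∀ x, inner ℂ ((n x : ℂ) ^ 2 * ((ψ x : ℂ) * u x)) (w j x)
        = (n x : ℂ) ^ 2 * starRingEnd ℂ (u x) * ((ψ x : ℂ) * w j x) := fun x => by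
      simp only [RCLike.inner_apply, map_mul, map_pow, Complex.conj_ofReal]
      ring
    simp_rw [e4]
    rw [← e]
    ring
  have hlim := tendsto_nhds_unique
    (((T1.neg.sub T2).add (T3.const_mul ((k : ℂ) ^ 2))).congr hzero) tendsto_const_nhds
  -- In the limit the integrands `ψ |g|²` and `n² ψ |u|²` are real, so the imaginary part retains
  -- only the term containing `∇ψ`.
  have r1 : (∫ x in Ω, inner ℂ ((ψ x : ℂ) • g x) (g x)).im = 0 := by
    rw [← RCLike.im_eq_complex_im, ← integral_im (integrable_inner_of_memLp m1 hu.memLp_grad)]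
    refine integral_eq_zero_of_ae (Eventually.of_forall fun x => ?_)
    simp [inner_self_eq_norm_sq_to_K, ← Complex.ofReal_pow]
  have r3 : (∫ x in Ω, inner ℂ ((n x : ℂ) ^ 2 * ((ψ x : ℂ) * u x)) (u x)).im = 0 := by
    rw [← RCLike.im_eq_complex_im, ← integral_im (integrable_inner_of_memLp m3 hu.memLp)]
    refine integral_eq_zero_of_ae (Eventually.of_forall fun x => ?_)
    have : inner ℂ ((n x : ℂ) ^ 2 * ((ψ x : ℂ) * u x)) (u x)
        = ((n x ^ 2 * ψ x * Complex.normSq (u x) : ℝ) : ℂ) := by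
      simp only [RCLike.inner_apply, map_mul, map_pow, Complex.conj_ofReal, Complex.ofReal_mul,
        Complex.ofReal_pow, ← Complex.mul_conj]
      ring
    exact (congrArg Complex.im this).trans (Complex.ofReal_im _)
  have e5 : ∀ x, inner ℂ (u x) (inner ℂ (grad (fun x => (ψ x : ℂ)) x) (g x) : ℂ)
      = starRingEnd ℂ (inner ℂ (inner ℂ (grad (fun x => (ψ x : ℂ)) x) (g x) : ℂ) (u x)) :=
    fun x => (inner_conj_symm _ _).symm
  simp_rw [e5]
  rw [integral_conj, Complex.conj_im, neg_eq_zero]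
  have h := congrArg Complex.im hlim
  have hk : ((k : ℂ) ^ 2).im = 0 := by simp [← Complex.ofReal_pow]
  rw [Complex.add_im, Complex.sub_im, Complex.neg_im, Complex.mul_im, r1, r3, hk,
    Complex.zero_im] at h
  linarith

end Test

/-- If `K` integrates to zero against all bounded continuous functions of `p`, then it integrates to
zero against all measurable functions of `p`. -/
theorem integral_comp_mul_eq_zero {α : Type*} [MeasurableSpace α] {μ : Measure α} {K : α → ℝ}
    (hK : Integrable K μ) {p : α → ℝ} (hp : Measurable p)
    (h : ∀ b : BoundedContinuousFunction ℝ ℝ, ∫ x, b (p x) * K x ∂μ = 0) {H : ℝ → ℝ}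
    (hH : Measurable H) (hi : Integrable (fun x => H (p x) * K x) μ) :
    ∫ x, H (p x) * K x ∂μ = 0 := by
  have hKm : AEMeasurable (fun x => ‖K x‖₊) μ := hK.1.aemeasurable.nnnorm
  -- The image of `|K| dμ` under `p` is a finite measure on the line, and bounded continuous
  -- functions are dense in its `L¹` space.
  set ν := μ.withDensity fun x => (‖K x‖₊ : ℝ≥0∞) with hν
  have : IsFiniteMeasure ν := isFiniteMeasure_withDensity hK.2.ne
  have hint : ∀ G : ℝ → ℝ, Measurable G →
      (Integrable G (ν.map p) ↔ Integrable (fun x => G (p x) * K x) μ) := fun G hG => by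
    rw [integrable_map_measure hG.aestronglyMeasurable hp.aemeasurable, hν,
      integrable_withDensity_iff_integrable_smul₀ hKm]
    have hm : AEStronglyMeasurable (fun x => G (p x)) μ :=
      (hG.comp hp).aestronglyMeasurable
    rw [← integrable_norm_iff, ← integrable_norm_iff (f := fun x => G (p x) * K x)]
    · refine integrable_congr (Eventually.of_forall fun x => ?_)
      simp [NNReal.smul_def, mul_comm]
    · exact hm.mul hK.1
    · exact hK.1.norm.mul hm
  refine eq_of_forall_dist_le fun ε hε => ?_
  obtain ⟨b, hb, hbi⟩ := ((hint H hH).2 hi).exists_boundedContinuous_integral_sub_le hε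
  have hb1 : Integrable (fun x => b (p x) * K x) μ := (hint b b.continuous.measurable).1 hbi
  have e : ∫ x, H (p x) * K x ∂μ = ∫ x, (H (p x) - b (p x)) * K x ∂μ := by
    simp_rw [sub_mul]
    rw [integral_sub hi hb1, h, sub_zero]
  rw [dist_zero_right, e]
  refine (norm_integral_le_integral_norm _).trans (le_trans (le_of_eq ?_) hb)
  have hm : AEStronglyMeasurable (fun x => ‖H x - b x‖) (ν.map p) :=
    (hH.sub b.continuous.measurable).norm.aestronglyMeasurable
  rw [integral_map hp.aemeasurable hm, hν, integral_withDensity_eq_integral_smul₀ hKm]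
  refine integral_congr_ae (Eventually.of_forall fun x => ?_)
  simp [NNReal.smul_def, mul_comm]

/-! ### Vanishing radial energy flux -/

section Flux

variable {d : ℕ} {u : E d → ℂ} {g : E d → V d} {k : ℝ} {n : E d → ℝ} {R : ℝ}

/-- The density `Im (ū ∂ᵣu)` of the radial energy flux. -/
noncomputable def flux {d : ℕ} (u : E d → ℂ) (g : E d → V d) (x : E d) : ℝ :=
  (inner ℂ (u x) (inner ℂ (radialDir x) (g x) : ℂ) : ℂ).im

theorem norm_smul_radialDir (x : E d) :
    ((‖x‖ : ℝ) : ℂ) • radialDir x = (WithLp.toLp 2 fun i => ((x i : ℝ) : ℂ) : V d) := by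
  ext i
  rcases eq_or_ne x 0 with rfl | hx
  · simp [radialDir]
  · have : ‖x‖ ≠ 0 := norm_ne_zero_iff.2 hx
    simp only [radialDir, PiLp.smul_apply, smul_eq_mul, ← Complex.ofReal_mul]
    congr 1
    field_simp

theorem norm_radialDir {x : E d} (hx : x ≠ 0) : ‖(radialDir x : V d)‖ = 1 := by
  have h := congrArg norm (norm_smul_radialDir x)
  have h2 : ‖(WithLp.toLp 2 fun i => ((x i : ℝ) : ℂ) : V d)‖ = ‖x‖ := by
    simp [EuclideanSpace.norm_eq]
  rw [norm_smul, h2, Complex.norm_real, norm_norm] at h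
  exact mul_left_cancel₀ (norm_ne_zero_iff.2 hx) (h.trans (mul_one _).symm)

theorem norm_radialDir_le (x : E d) : ‖(radialDir x : V d)‖ ≤ 1 := by
  rcases eq_or_ne x 0 with rfl | hx
  · have : (radialDir 0 : V d) = 0 := by ext i; simp [radialDir]
    simp [this]
  · exact (norm_radialDir hx).le

theorem measurable_radialDir : Measurable (radialDir : E d → V d) := by
  refine (PiLp.continuous_toLp 2 _).measurable.comp (measurable_pi_lambda _ fun i => ?_)
  exact Complex.measurable_ofReal.comp
    ((PiLp.continuous_apply 2 _ i).measurable.div measurable_norm)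

theorem abs_flux_le (x : E d) : |flux u g x| ≤ ‖u x‖ * ‖g x‖ := by
  refine (Complex.abs_im_le_norm _).trans ((norm_inner_le_norm _ _).trans ?_)
  refine mul_le_mul_of_nonneg_left ((norm_inner_le_norm _ _).trans ?_) (norm_nonneg _)
  exact mul_le_of_le_one_left (norm_nonneg _) (norm_radialDir_le x)

theorem aestronglyMeasurable_flux {μ : Measure (E d)} (hu : AEStronglyMeasurable u μ)
    (hg : AEStronglyMeasurable g μ) : AEStronglyMeasurable (flux u g) μ :=
  Complex.continuous_im.comp_aestronglyMeasurable
    (hu.inner (measurable_radialDir.aestronglyMeasurable.inner hg))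

theorem integrable_flux {μ : Measure (E d)} (hu : MemLp u 2 μ) (hg : MemLp g 2 μ) :
    Integrable (flux u g) μ :=
  (hu.norm.integrable_mul hg.norm).mono' (aestronglyMeasurable_flux hu.1 hg.1)
    (Eventually.of_forall abs_flux_le)

theorem grad_comp_norm_sq {θ : ℝ → ℝ} (hθ : Differentiable ℝ θ) (x : E d) :
    grad (fun x => ((θ (‖x‖ ^ 2) : ℝ) : ℂ)) x
      = ((2 * (deriv θ (‖x‖ ^ 2) * ‖x‖) : ℝ) : ℂ) • radialDir x := by
  have h1 : HasFDerivAt (fun x : E d => ‖x‖ ^ 2) (2 • innerSL ℝ x) x :=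
    (hasStrictFDerivAt_norm_sq x).hasFDerivAt
  have h2 : HasFDerivAt (fun x : E d => θ (‖x‖ ^ 2)) _ x :=
    (hθ (‖x‖ ^ 2)).hasDerivAt.hasFDerivAt.comp x h1
  have h3 : HasFDerivAt (fun x : E d => ((θ (‖x‖ ^ 2) : ℝ) : ℂ)) _ x :=
    Complex.ofRealCLM.hasFDerivAt.comp x h2
  have h4 : ((2 * (deriv θ (‖x‖ ^ 2) * ‖x‖) : ℝ) : ℂ) • (radialDir x : V d)
      = ((2 * deriv θ (‖x‖ ^ 2) : ℝ) : ℂ) • ((‖x‖ : ℝ) : ℂ) • radialDir x := by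
    rw [smul_smul, ← Complex.ofReal_mul, mul_assoc]
  rw [h4, norm_smul_radialDir]
  ext i
  simp only [grad, h3.fderiv]
  simp [EuclideanSpace.inner_single_right]
  ring

/-- Take `ψ(x) = θ(|x|²)` with `θ` the primitive of `h` that vanishes at `a`, hence beyond `a`. Its
gradient is `2 h(|x|²) |x|` times the radial direction. Working with `|x|²` keeps `ψ` of class `C¹`
at the origin. -/
theorem IsSolPair.integral_continuous_flux (hn : MemLp n ⊤ volume)
    (hu : IsSolPair k n (fun _ => 0) (ball 0 R) u g) {h : ℝ → ℝ} (hc : Continuous h) {a : ℝ}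
    (ha : a < R ^ 2) (hR : 0 < R) (h0 : ∀ s, a ≤ s → h s = 0) :
    ∫ x in ball 0 R, h (‖x‖ ^ 2) * (‖x‖ * flux u g x) = 0 := by
  set θ : ℝ → ℝ := fun s => ∫ t in a..s, h t with hθ
  have hd : ∀ s, HasDerivAt θ (h s) s := fun s =>
    intervalIntegral.integral_hasDerivAt_right (hc.intervalIntegrable _ _)
      (hc.stronglyMeasurableAtFilter _ _) hc.continuousAt
  have hd' : deriv θ = h := funext fun s => (hd s).deriv
  have hdiff : Differentiable ℝ θ := fun s => (hd s).differentiableAt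
  have hθ1 : ContDiff ℝ 1 θ := contDiff_one_iff_deriv.2 ⟨hdiff, hd' ▸ hc⟩
  have hθ0 : ∀ s, a ≤ s → θ s = 0 := fun s hs => by
    rw [hθ]
    refine intervalIntegral.integral_zero_ae (Eventually.of_forall fun t ht => ?_)
    rw [Set.uIoc_of_le hs] at ht
    exact h0 t ht.1.le
  have hψ : ContDiff ℝ 1 fun x : E d => θ (‖x‖ ^ 2) := hθ1.comp (contDiff_norm_sq ℝ)
  have hK : ∀ x : E d, x ∉ closedBall (0 : E d) (√a) → θ (‖x‖ ^ 2) = 0 := fun x hx => by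
    refine hθ0 _ ?_
    rw [mem_closedBall_zero_iff, not_le] at hx
    exact (Real.lt_sq_of_sqrt_lt hx).le
  have hts : tsupport (fun x : E d => θ (‖x‖ ^ 2)) ⊆ closedBall (0 : E d) (√a) :=
    closure_minimal (fun x hx => by_contra fun h => hx (hK x h)) isClosed_closedBall
  have haR : √a < R := (Real.sqrt_lt' hR).2 ha
  have key := hu.integral_flux_eq_zero isOpen_ball hn hψ
    (HasCompactSupport.intro (isCompact_closedBall _ _) hK)
    (hts.trans (closedBall_subset_ball haR))
  simp_rw [grad_comp_norm_sq hdiff, hd', inner_smul_left, Complex.conj_ofReal,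
    ← smul_eq_mul (a := ((_ : ℝ) : ℂ)), inner_smul_right] at key
  have hint : Integrable (fun x => ((2 * (h (‖x‖ ^ 2) * ‖x‖) : ℝ) : ℂ) *
      inner ℂ (u x) (inner ℂ (radialDir x) (g x) : ℂ)) (volume.restrict (ball 0 R)) := by
    obtain ⟨C, hC⟩ := isCompact_Icc.exists_bound_of_continuousOn (s := Set.Icc 0 (R ^ 2))
      hc.continuousOn
    have hcm : Continuous fun x : E d => ((2 * (h (‖x‖ ^ 2) * ‖x‖) : ℝ) : ℂ) := by fun_prop
    refine ((hu.memLp.norm.integrable_mul hu.memLp_grad.norm).const_mul (2 * (C * R))).mono'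
      (hcm.aestronglyMeasurable.mul (hu.memLp.1.inner
        (measurable_radialDir.aestronglyMeasurable.inner hu.memLp_grad.1))) ?_
    rw [ae_restrict_iff' measurableSet_ball]
    refine Eventually.of_forall fun x hx => ?_
    rw [mem_ball_zero_iff] at hx
    have h1 := hC (‖x‖ ^ 2) ⟨sq_nonneg _, pow_le_pow_left₀ (norm_nonneg x) hx.le 2⟩
    have h2 : ‖inner ℂ (u x) (inner ℂ (radialDir x) (g x) : ℂ)‖ ≤ ‖u x‖ * ‖g x‖ :=
      (norm_inner_le_norm _ _).trans (mul_le_mul_of_nonneg_left ((norm_inner_le_norm _ _).trans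
        (mul_le_of_le_one_left (norm_nonneg _) (norm_radialDir_le x))) (norm_nonneg _))
    have h3 : 0 ≤ C := (norm_nonneg _).trans h1
    rw [norm_mul, Complex.norm_real, norm_mul, norm_mul, norm_norm, Real.norm_two]
    simp only [Pi.mul_apply]
    gcongr
  rw [← RCLike.im_eq_complex_im, ← integral_im hint] at key
  have e : ∀ x, RCLike.im (((2 * (h (‖x‖ ^ 2) * ‖x‖) : ℝ) : ℂ) *
      inner ℂ (u x) (inner ℂ (radialDir x) (g x) : ℂ))
      = 2 * (h (‖x‖ ^ 2) * (‖x‖ * flux u g x)) := fun x => by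
    rw [RCLike.im_eq_complex_im, Complex.im_ofReal_mul, flux]
    ring
  simp_rw [e] at key
  rw [integral_const_mul] at key
  linarith

theorem IsSolPair.integral_boundedContinuous_flux (hn : MemLp n ⊤ volume)
    (hu : IsSolPair k n (fun _ => 0) (ball 0 R) u g) (hR : 0 < R)
    (b : BoundedContinuousFunction ℝ ℝ) :
    ∫ x in ball 0 R, b (‖x‖ ^ 2) * (‖x‖ * flux u g x) = 0 := by
  -- A cutoff that is `0` where `j (R² - s) ≤ 1` and `1` where `j (R² - s) ≥ 2`; it removes the
  -- support condition by dominated convergence.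
  set χ : ℕ → ℝ → ℝ := fun j s => max 0 (min 1 (j * (R ^ 2 - s) - 1)) with hχ
  have hχ1 : ∀ j s, |χ j s| ≤ 1 := fun j s => by
    rw [abs_of_nonneg (le_max_left _ _)]
    exact max_le zero_le_one (min_le_left _ _)
  have hz : ∀ j : ℕ, ∫ x in ball 0 R, (χ j (‖x‖ ^ 2) * b (‖x‖ ^ 2)) * (‖x‖ * flux u g x) = 0 := by
    intro j
    have hj : (0 : ℝ) < 1 / (j + 1) := by positivity
    -- The denominator `j + 1` gives a threshold strictly below `R²` for every `j`, including `j =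
    -- 0`.
    refine hu.integral_continuous_flux hn (h := fun s => χ j s * b s) (by fun_prop)
      (a := R ^ 2 - 1 / (j + 1)) (by linarith) hR fun s hs => ?_
    have h1 : (j : ℝ) * (R ^ 2 - s) ≤ 1 := by
      have h2 : (j : ℝ) * (R ^ 2 - s) ≤ j * (1 / (j + 1)) := by gcongr; linarith
      refine h2.trans ?_
      rw [mul_one_div, div_le_one (by positivity)]
      linarith
    have h3 : χ j s = 0 := max_eq_left ((min_le_right _ _).trans (by linarith))
    rw [h3, zero_mul]
  have hlim : Tendsto (fun j : ℕ => ∫ x in ball 0 R,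
      (χ j (‖x‖ ^ 2) * b (‖x‖ ^ 2)) * (‖x‖ * flux u g x)) atTop
      (𝓝 (∫ x in ball 0 R, b (‖x‖ ^ 2) * (‖x‖ * flux u g x))) := by
    have hfm : AEStronglyMeasurable (fun x => ‖x‖ * flux u g x) (volume.restrict (ball 0 R)) :=
      continuous_norm.aestronglyMeasurable.mul
        (aestronglyMeasurable_flux hu.memLp.1 hu.memLp_grad.1)
    refine tendsto_integral_of_dominated_convergence
      (fun x => ‖b‖ * (R * |flux u g x|)) (fun j => ?_)
      (((integrable_flux hu.memLp hu.memLp_grad).abs.const_mul R).const_mul _)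
      (fun j => ?_) ?_
    · have : Continuous fun x : E d => χ j (‖x‖ ^ 2) * b (‖x‖ ^ 2) := by fun_prop
      exact this.aestronglyMeasurable.mul hfm
    · rw [ae_restrict_iff' measurableSet_ball]
      refine Eventually.of_forall fun x hx => ?_
      rw [mem_ball_zero_iff] at hx
      rw [norm_mul, norm_mul, norm_mul, norm_norm, Real.norm_eq_abs (χ _ _),
        Real.norm_eq_abs (flux _ _ _)]
      have := b.norm_coe_le_norm (‖x‖ ^ 2)
      have := hχ1 j (‖x‖ ^ 2)
      calc _ ≤ (1 * ‖b‖) * (R * |flux u g x|) := by gcongr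
        _ = _ := by ring
    · rw [ae_restrict_iff' measurableSet_ball]
      refine Eventually.of_forall fun x hx => ?_
      rw [mem_ball_zero_iff] at hx
      have hpos : 0 < R ^ 2 - ‖x‖ ^ 2 := by
        have := pow_lt_pow_left₀ hx (norm_nonneg x) two_ne_zero
        linarith
      have hev : ∀ᶠ j : ℕ in atTop, χ j (‖x‖ ^ 2) = 1 := by
        obtain ⟨N, hN⟩ := exists_nat_gt (2 / (R ^ 2 - ‖x‖ ^ 2))
        filter_upwards [eventually_ge_atTop N] with j hj
        have h1 : 2 ≤ (j : ℝ) * (R ^ 2 - ‖x‖ ^ 2) := by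
          rw [← div_le_iff₀ hpos]
          exact hN.le.trans (Nat.cast_le.2 hj)
        have h2 : min 1 ((j : ℝ) * (R ^ 2 - ‖x‖ ^ 2) - 1) = 1 := min_eq_left (by linarith)
        simp only [hχ, h2]
        norm_num
      refine tendsto_const_nhds.congr' ?_
      filter_upwards [hev] with j hj
      rw [hj, one_mul]
  exact tendsto_nhds_unique hlim (by simp_rw [hz]; exact tendsto_const_nhds)

/-- The energy flux of a homogeneous solution, integrated against a radial function, vanishes. -/
theorem IsSolPair.integral_radial_mul_flux (hn : MemLp n ⊤ volume)
    (hu : IsSolPair k n (fun _ => 0) (ball 0 R) u g) (hR : 0 < R) {H : ℝ → ℝ}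
    (hH : Measurable H)
    (hi : Integrable (fun x => H ‖x‖ * flux u g x) (volume.restrict (ball 0 R))) :
    ∫ x in ball 0 R, H ‖x‖ * flux u g x = 0 := by
  -- The weight is rewritten in the variable `s = |x|²`. At the origin both sides vanish because
  -- `radialDir 0 = 0`.
  have e : ∀ x : E d, (fun s => H (√s) / √s) (‖x‖ ^ 2) * (‖x‖ * flux u g x)
      = H ‖x‖ * flux u g x := fun x => by
    rcases eq_or_ne x 0 with rfl | hx
    · have : (radialDir 0 : V d) = 0 := by ext i; simp [radialDir]
      simp [flux, this]
    · have : ‖x‖ ≠ 0 := norm_ne_zero_iff.2 hx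
      simp only [Real.sqrt_sq (norm_nonneg x)]
      field_simp
  simp_rw [← e] at hi ⊢
  refine integral_comp_mul_eq_zero (p := fun x => ‖x‖ ^ 2) (H := fun s => H (√s) / √s) ?_
    (continuous_norm.pow 2).measurable (hu.integral_boundedContinuous_flux hn hR) ?_ hi
  · have hf := integrable_flux hu.memLp hu.memLp_grad
    refine (hf.norm.const_mul R).mono'
      (continuous_norm.aestronglyMeasurable.mul hf.1) ?_
    rw [ae_restrict_iff' measurableSet_ball]
    refine Eventually.of_forall fun x hx => ?_
    rw [mem_ball_zero_iff] at hx
    rw [norm_mul, norm_norm]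
    gcongr
  · exact (hH.comp Real.continuous_sqrt.measurable).div Real.continuous_sqrt.measurable

end Flux

/-! ### Spherical means -/

section SphereMean

variable {d : ℕ}

theorem measurable_sphereMean {n : E d → ℝ} (hn : StronglyMeasurable n) :
    Measurable (sphereMean n) := by
  have h : StronglyMeasurable fun p : ℝ × sphere (0 : E d) 1 => n (p.1 • (p.2 : E d)) :=
    hn.comp_measurable (by fun_prop)
  have h2 := h.integral_prod_right' (ν := (volume : Measure (E d)).toSphere)
  have e : sphereMean n = fun r => ((volume : Measure (E d)).toSphere.real Set.univ)⁻¹ •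
      ∫ θ : sphere (0 : E d) 1, n (r • (θ : E d)) ∂((volume : Measure (E d)).toSphere) := by
    funext r
    rw [sphereMean, average_eq]
  rw [e]
  exact h2.measurable.const_smul ((volume : Measure (E d)).toSphere.real Set.univ)⁻¹

variable [Nonempty (Fin d)]

/-- In polar coordinates Fubini shows that a null set meets almost every sphere in a null set. -/
theorem ae_sphereMean_congr {n n' : E d → ℝ} (h : n =ᵐ[volume] n') :
    ∀ᵐ x : E d, sphereMean n ‖x‖ = sphereMean n' ‖x‖ := by
  have hmp := (volume : Measure (E d)).measurePreserving_homeomorphUnitSphereProd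
  set σ := (volume : Measure (E d)).toSphere
  set τ := Measure.volumeIoiPow (Module.finrank ℝ (E d) - 1)
  have hs : MeasurableSet ({0}ᶜ : Set (E d)) := (measurableSet_singleton 0).compl
  have h1 : ∀ᵐ y : ({0}ᶜ : Set (E d)) ∂((volume : Measure (E d)).comap Subtype.val), n y = n' y :=
    (ae_restrict_iff_subtype hs).1 (ae_restrict_of_ae h)
  have h2 : ∀ᵐ p ∂(σ.prod τ), n ((p.2 : ℝ) • (p.1 : E d)) = n' ((p.2 : ℝ) • (p.1 : E d)) := by
    have := (hmp.symm (homeomorphUnitSphereProd (E d)).toMeasurableEquiv).quasiMeasurePreserving.ae h1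
    simpa using this
  have h3 : ∀ᵐ r : Set.Ioi (0 : ℝ) ∂τ, sphereMean n r = sphereMean n' r := by
    have h4 := (Measure.measurePreserving_swap (μ := τ) (ν := σ)).quasiMeasurePreserving.ae h2
    filter_upwards [Measure.ae_ae_of_ae_prod h4] with r hr
    exact average_congr hr
  have h5 : ∀ᵐ p ∂(σ.prod τ), sphereMean n p.2 = sphereMean n' p.2 :=
    Measure.quasiMeasurePreserving_snd.ae h3
  have h6 := hmp.quasiMeasurePreserving.ae h5
  have h7 : ∀ᵐ y : ({0}ᶜ : Set (E d)) ∂((volume : Measure (E d)).comap Subtype.val),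
      sphereMean n ‖(y : E d)‖ = sphereMean n' ‖(y : E d)‖ := by simpa using h6
  have h8 := (ae_restrict_iff_subtype (p := fun x => sphereMean n ‖x‖ = sphereMean n' ‖x‖) hs).2 h7
  rwa [restrict_compl_singleton] at h8

/-- Averaging a strongly measurable representative of `n` yields a Borel function of the radius, as
needed for a radial weight. The constants `ε` and `M` are the two `L^∞` norms. -/
theorem exists_radial_contrast {n : E d → ℝ} (hn : MemLp n ⊤ volume)
    (hsmall : eLpNorm (fun x => 1 - sphereMean n ‖x‖ / n x) ⊤ volume < 1) :
    ∃ (N : ℝ → ℝ) (ε M : ℝ), Measurable N ∧ ε < 1 ∧ ∀ᵐ x : E d,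
      |n x| ≤ M ∧ |1 - N ‖x‖ / n x| ≤ ε := by
  refine ⟨sphereMean (hn.1.mk n), (eLpNorm (fun x => 1 - sphereMean n ‖x‖ / n x) ⊤ volume).toReal,
    (eLpNorm n ⊤ volume).toReal, measurable_sphereMean hn.1.stronglyMeasurable_mk, ?_, ?_⟩
  · exact (ENNReal.toReal_lt_toReal hsmall.ne_top ENNReal.one_ne_top).2 hsmall
  · have key : ∀ F : E d → ℝ, eLpNorm F ⊤ volume ≠ ⊤ →
        ∀ᵐ x, |F x| ≤ (eLpNorm F ⊤ volume).toReal := fun F hF => by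
      filter_upwards [ae_le_eLpNormEssSup (f := F) (μ := volume)] with x hx
      rw [← eLpNorm_exponent_top] at hx
      have := ENNReal.toReal_mono hF hx
      simpa using this
    filter_upwards [ae_sphereMean_congr hn.1.ae_eq_mk, key _ hn.2.ne, key _ hsmall.ne_top]
      with x h1 h2 h3
    exact ⟨h2, h1 ▸ h3⟩

end SphereMean

theorem eLpNorm_two_eq_ofReal_sqrt {α X : Type*} [MeasurableSpace α] {μ : Measure α}
    [NormedAddCommGroup X] {F : α → X} (hF : MemLp F 2 μ) :
    eLpNorm F 2 μ = ENNReal.ofReal √(∫ x, ‖F x‖ ^ 2 ∂μ) := by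
  rw [hF.eLpNorm_eq_integral_rpow_norm two_ne_zero ENNReal.ofNat_ne_top]
  simp [Real.sqrt_eq_rpow]

/-! ### Coercivity of the radiation seminorm -/

section Coercivity

variable {d : ℕ} {Ω Ω' : Set (E d)} {u v : E d → ℂ} {g h : E d → V d} {k : ℝ} {n : E d → ℝ}
  {R : ℝ}

/-- The integrand `(∇u - i k n u x/|x|) (1 + |x|)^{-1/2}` of the radiation seminorm. -/
noncomputable def radField {d : ℕ} (k : ℝ) (n : E d → ℝ) (u : E d → ℂ) (g : E d → V d)
    (x : E d) : V d :=
  (((√(1 + ‖x‖))⁻¹ : ℝ) : ℂ) •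
    (g x - (Complex.I * (k : ℂ) * (n x : ℂ) * u x) • radialDir x)

theorem memLp_mul_smul_radialDir (hn : MemLp n ⊤ volume) (hu : MemLp u 2 (volume.restrict Ω)) :
    MemLp (fun x => (Complex.I * (k : ℂ) * (n x : ℂ) * u x) • (radialDir x : V d)) 2
      (volume.restrict Ω) := by
  have h1 : MemLp (fun x => Complex.I * (k : ℂ) * (n x : ℂ) * u x) 2 (volume.restrict Ω) := by
    have := (memLp_top_smul (memLp_ofReal_top hn) hu).const_mul (Complex.I * (k : ℂ))
    simpa [mul_assoc] using this
  refine h1.of_le (h1.1.smul measurable_radialDir.aestronglyMeasurable)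
    (Eventually.of_forall fun x => ?_)
  rw [norm_smul]
  exact mul_le_of_le_one_right (norm_nonneg _) (norm_radialDir_le x)

theorem sqrt_one_add_norm_pos (x : E d) : 0 < √(1 + ‖x‖) :=
  Real.sqrt_pos.2 (by positivity)

theorem memLp_radField (hn : MemLp n ⊤ volume) (hu : MemLp u 2 (volume.restrict Ω))
    (hg : MemLp g 2 (volume.restrict Ω)) :
    MemLp (radField k n u g) 2 (volume.restrict Ω) := by
  have h1 := hg.sub (memLp_mul_smul_radialDir (k := k) hn hu)
  have hc : Continuous fun x : E d => (((√(1 + ‖x‖))⁻¹ : ℝ) : ℂ) :=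
    Complex.continuous_ofReal.comp
      ((by fun_prop : Continuous fun x : E d => √(1 + ‖x‖)).inv₀
        fun x => (sqrt_one_add_norm_pos x).ne')
  refine h1.of_le (hc.aestronglyMeasurable.smul h1.1) (Eventually.of_forall fun x => ?_)
  rw [radField, norm_smul, Complex.norm_real]
  refine mul_le_of_le_one_left (norm_nonneg _) ?_
  rw [norm_inv, Real.norm_of_nonneg (Real.sqrt_nonneg _)]
  refine inv_le_one_of_one_le₀ (Real.one_le_sqrt.2 ?_)
  linarith [norm_nonneg x]

theorem radSeminorm_eq (hΩ : IsOpen Ω) (hu : HasWeakGradOn Ω u g) :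
    radSeminorm k n Ω u = eLpNorm (radField k n u g) 2 (volume.restrict Ω) := by
  rw [eLpNorm_eq_lintegral_rpow_enorm_toReal two_ne_zero ENNReal.ofNat_ne_top, radSeminorm]
  simp only [ENNReal.toReal_ofNat]
  congr 1
  refine lintegral_congr_ae ?_
  filter_upwards [hu.weakGrad_ae_eq hΩ] with x hx
  have h0 : (0 : ℝ) ≤ 1 + ‖x‖ := by positivity
  rw [hx, radField, enorm_smul, ENNReal.mul_rpow_of_nonneg _ _ two_pos.le, ENNReal.rpow_two,
    ENNReal.rpow_two, div_eq_mul_inv]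
  refine (mul_comm _ _).trans (congrArg (· * _) ?_)
  rw [← ofReal_norm (((√(1 + ‖x‖))⁻¹ : ℝ) : ℂ), Complex.norm_real, Real.norm_of_nonneg (by positivity),
    ← ENNReal.ofReal_pow (by positivity), inv_pow, Real.sq_sqrt h0,
    ENNReal.ofReal_inv_of_pos (by positivity)]

theorem norm_sub_smul_radialDir_sq {x : E d} (hx : x ≠ 0) :
    ‖g x - (Complex.I * (k : ℂ) * (n x : ℂ) * u x) • radialDir x‖ ^ 2
      = ‖g x‖ ^ 2 - 2 * (k * n x * flux u g x) + (k * n x * ‖u x‖) ^ 2 := by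
  have e : RCLike.re (inner ℂ (g x) ((Complex.I * (k : ℂ) * (n x : ℂ) * u x) • radialDir x))
      = k * n x * flux u g x := by
    rw [inner_re_symm, inner_smul_left, flux]
    simp only [RCLike.inner_apply, map_mul, Complex.conj_I, Complex.conj_ofReal,
      RCLike.re_eq_complex_re]
    have : -Complex.I * (k : ℂ) * (n x : ℂ) * (starRingEnd ℂ) (u x) * inner ℂ (radialDir x) (g x)
        = ((k * n x : ℝ) : ℂ) *
          (-Complex.I * (inner ℂ (radialDir x) (g x) * (starRingEnd ℂ) (u x))) := by
      push_cast
      ring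
    rw [this, Complex.re_ofReal_mul]
    simp
  rw [@norm_sub_sq ℂ, e, norm_smul, norm_radialDir hx]
  simp only [norm_mul, Complex.norm_I, Complex.norm_real, one_mul, mul_one]
  congr 1
  rw [mul_pow, mul_pow, mul_pow, mul_pow, Real.norm_eq_abs, Real.norm_eq_abs, sq_abs, sq_abs]

theorem norm_radField_sq (x : E d) :
    ‖radField k n u g x‖ ^ 2
      = ‖g x - (Complex.I * (k : ℂ) * (n x : ℂ) * u x) • radialDir x‖ ^ 2 / (1 + ‖x‖) := by
  have h0 : (0 : ℝ) ≤ 1 + ‖x‖ := by positivity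
  rw [radField, norm_smul, mul_pow, Complex.norm_real, Real.norm_of_nonneg (by positivity), inv_pow,
    Real.sq_sqrt h0, inv_mul_eq_div]

/-- Split `n = s + (n - s)` in the cross term of the square. The part with `s` is moved to the
right; the other is at most `2kεn|u||g| ≤ ε(|g|² + k²n²|u|²)`. The remaining multiple `1 - ε` of
`|g|²` is dropped. -/
theorem le_norm_radField_sq_add {nstar ε s : ℝ} (hk : 0 < k) (hns : 0 < nstar)
    {x : E d} (hx : x ≠ 0) (hnx : nstar ≤ n x) (hs : |1 - s / n x| ≤ ε) (hε : ε < 1)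
    (hxR : ‖x‖ ≤ R) :
    (1 - ε) * (k * nstar) ^ 2 / (1 + R) * ‖u x‖ ^ 2
      ≤ ‖radField k n u g x‖ ^ 2 + 2 * k * (s / (1 + ‖x‖) * flux u g x) := by
  have h0 : (0 : ℝ) < 1 + ‖x‖ := by positivity
  have hn0 : 0 < n x := hns.trans_le hnx
  have hε0 : 0 ≤ ε := (abs_nonneg _).trans hs
  have h1 : |n x - s| ≤ ε * n x := by
    have : n x - s = (1 - s / n x) * n x := by field_simp
    rw [this, abs_mul, abs_of_pos hn0]
    gcongr
  have h2 : (n x - s) * flux u g x ≤ ε * n x * (‖u x‖ * ‖g x‖) :=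
    (le_abs_self _).trans (by rw [abs_mul]; gcongr; exact abs_flux_le x)
  have h3 : (1 - ε) * (k * nstar) ^ 2 * ‖u x‖ ^ 2 ≤ (1 - ε) * (k * n x * ‖u x‖) ^ 2 := by
    rw [mul_pow _ ‖u x‖, ← mul_assoc]
    have : 0 ≤ 1 - ε := by linarith
    gcongr
  have h4 : 2 * (k * ((n x - s) * flux u g x))
      ≤ ε * (‖g x‖ ^ 2 + (k * n x * ‖u x‖) ^ 2) := by
    have : k * ((n x - s) * flux u g x) ≤ k * (ε * n x * (‖u x‖ * ‖g x‖)) := by gcongr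
    nlinarith [mul_nonneg hε0 (sq_nonneg (‖g x‖ - k * n x * ‖u x‖))]
  rw [norm_radField_sq, norm_sub_smul_radialDir_sq hx]
  have h5 : (1 - ε) * (k * nstar) ^ 2 * ‖u x‖ ^ 2
      ≤ ‖g x‖ ^ 2 - 2 * (k * n x * flux u g x) + (k * n x * ‖u x‖) ^ 2
        + 2 * k * (s * flux u g x) := by
    nlinarith [mul_nonneg (sub_nonneg.2 hε.le) (sq_nonneg ‖g x‖)]
  have h6 : 0 ≤ (1 - ε) * (k * nstar) ^ 2 * ‖u x‖ ^ 2 := by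
    have : 0 ≤ 1 - ε := by linarith
    positivity
  calc (1 - ε) * (k * nstar) ^ 2 / (1 + R) * ‖u x‖ ^ 2
      = (1 - ε) * (k * nstar) ^ 2 * ‖u x‖ ^ 2 / (1 + R) := by ring
    _ ≤ (1 - ε) * (k * nstar) ^ 2 * ‖u x‖ ^ 2 / (1 + ‖x‖) := by gcongr
    _ ≤ (‖g x‖ ^ 2 - 2 * (k * n x * flux u g x) + (k * n x * ‖u x‖) ^ 2
        + 2 * k * (s * flux u g x)) / (1 + ‖x‖) := by gcongr
    _ = _ := by ring

/-- The radiation seminorm is coercive on homogeneous solutions. -/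
theorem exists_coercivity_bound [Nonempty (Fin d)] (hk : 0 < k) (hn : MemLp n ⊤ volume)
    {nstar : ℝ} (hns : 0 < nstar) (hnlow : ∀ᵐ x, nstar ≤ n x)
    (hsmall : eLpNorm (fun x => 1 - sphereMean n ‖x‖ / n x) ⊤ volume < 1) (hR : 0 < R) :
    ∃ C : ℝ, 0 < C ∧ ∀ (u : E d → ℂ) (g : E d → V d),
      IsSolPair k n (fun _ => 0) (ball 0 R) u g →
        eLpNorm u 2 (volume.restrict (ball 0 R))
          ≤ ENNReal.ofReal C * eLpNorm (radField k n u g) 2 (volume.restrict (ball 0 R)) := by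
  obtain ⟨N, ε, M, hN, hε, hall⟩ := exists_radial_contrast hn hsmall
  set c : ℝ := (1 - ε) * (k * nstar) ^ 2 / (1 + R) with hc
  have hc0 : 0 < c := by
    have : 0 < 1 - ε := by linarith
    positivity
  refine ⟨√(c⁻¹), Real.sqrt_pos.2 (inv_pos.2 hc0), fun u g hu => ?_⟩
  have hv := memLp_radField (k := k) hn hu.memLp hu.memLp_grad
  have hHm : Measurable fun r : ℝ => N r / (1 + r) := by fun_prop
  have hfl := integrable_flux hu.memLp hu.memLp_grad
  have hi : Integrable (fun x => N ‖x‖ / (1 + ‖x‖) * flux u g x)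
      (volume.restrict (ball 0 R)) := by
    refine (hfl.norm.const_mul (2 * M)).mono'
      ((hHm.comp measurable_norm).aestronglyMeasurable.mul hfl.1) ?_
    filter_upwards [ae_restrict_of_ae hall, ae_restrict_of_ae hnlow] with x ⟨h1, h2⟩ h3
    have h0 : 0 < n x := hns.trans_le h3
    have h4 : |N ‖x‖| ≤ 2 * M := by
      have h5 : |N ‖x‖ / n x| ≤ 2 := by
        rw [abs_le] at h2 ⊢
        constructor <;> linarith
      have h6 : N ‖x‖ = N ‖x‖ / n x * n x := by field_simp
      rw [h6, abs_mul]
      gcongr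
    rw [norm_mul, norm_div, Real.norm_eq_abs (N _), Real.norm_of_nonneg (by positivity : 0 ≤ 1 + ‖x‖)]
    gcongr
    refine (div_le_self (abs_nonneg _) ?_).trans h4
    linarith [norm_nonneg x]
  -- The weight `N(|x|) / (1 + |x|)` is radial, so the extra term of the pointwise bound integrates
  -- to zero.
  have hzero := hu.integral_radial_mul_flux hn hR hHm hi
  have hsq := hu.memLp.integrable_norm_pow two_ne_zero
  have hvsq := hv.integrable_norm_pow two_ne_zero
  have hle : c * ∫ x in ball 0 R, ‖u x‖ ^ 2 ≤ ∫ x in ball 0 R, ‖radField k n u g x‖ ^ 2 := by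
    have h1 : ∫ x in ball 0 R, c * ‖u x‖ ^ 2
        ≤ ∫ x in ball 0 R, (‖radField k n u g x‖ ^ 2
          + 2 * k * (N ‖x‖ / (1 + ‖x‖) * flux u g x)) := by
      refine integral_mono_ae (hsq.const_mul c) (hvsq.add (hi.const_mul _)) ?_
      have hx0 : ∀ᵐ x : E d, x ≠ 0 := by
        rw [ae_iff]
        simp
      filter_upwards [ae_restrict_of_ae hall, ae_restrict_of_ae hnlow, ae_restrict_of_ae hx0,
        ae_restrict_mem measurableSet_ball] with x ⟨_, h2⟩ h3 h4 h5
      exact le_norm_radField_sq_add hk hns h4 h3 h2 hε (mem_ball_zero_iff.1 h5).le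
    rw [integral_const_mul, integral_add hvsq (hi.const_mul _), integral_const_mul, hzero,
      mul_zero, add_zero] at h1
    exact h1
  rw [eLpNorm_two_eq_ofReal_sqrt hu.memLp, eLpNorm_two_eq_ofReal_sqrt hv,
    ← ENNReal.ofReal_mul (Real.sqrt_nonneg _), ← Real.sqrt_mul (inv_nonneg.2 hc0.le)]
  refine ENNReal.ofReal_le_ofReal (Real.sqrt_le_sqrt ?_)
  rwa [inv_mul_eq_div, le_div_iff₀ hc0, mul_comm]

end Coercivity

/-! ### The closed set of solutions in `L² × L²` and minimization -/

section Closed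

variable {d : ℕ} {u : E d → ℂ} {g v : E d → V d} {k : ℝ} {n : E d → ℝ}
  {R : ℝ} {F : (E d → ℂ) → ℂ}

/-- The gradient recovered from `u` and the integrand `v` of the radiation seminorm. -/
noncomputable def gradOf {d : ℕ} (k : ℝ) (n : E d → ℝ) (u : E d → ℂ) (v : E d → V d)
    (x : E d) : V d :=
  ((√(1 + ‖x‖) : ℝ) : ℂ) • v x + (Complex.I * (k : ℂ) * (n x : ℂ) * u x) • radialDir x

theorem radField_gradOf (u : E d → ℂ) (v : E d → V d) :
    radField k n u (gradOf k n u v) = v := by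
  funext x
  have h := (sqrt_one_add_norm_pos x).ne'
  rw [radField, gradOf, add_sub_cancel_right, smul_smul, ← Complex.ofReal_mul, inv_mul_cancel₀ h,
    Complex.ofReal_one, one_smul]

theorem gradOf_radField (u : E d → ℂ) (g : E d → V d) :
    gradOf k n u (radField k n u g) = g := by
  funext x
  have h := (sqrt_one_add_norm_pos x).ne'
  rw [gradOf, radField, smul_smul, ← Complex.ofReal_mul, mul_inv_cancel₀ h,
    Complex.ofReal_one, one_smul, sub_add_cancel]

theorem memLp_top_sqrt :
    MemLp (fun x : E d => ((√(1 + ‖x‖) : ℝ) : ℂ)) ⊤ (volume.restrict (ball 0 R)) := by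
  have hc : Continuous fun x : E d => ((√(1 + ‖x‖) : ℝ) : ℂ) := by fun_prop
  refine memLp_top_of_bound hc.aestronglyMeasurable (√(1 + R)) ?_
  filter_upwards [ae_restrict_mem measurableSet_ball] with x hx
  rw [mem_ball_zero_iff] at hx
  rw [Complex.norm_real, Real.norm_of_nonneg (Real.sqrt_nonneg _)]
  exact Real.sqrt_le_sqrt (by linarith)

theorem memLp_gradOf (hn : MemLp n ⊤ volume) (hu : MemLp u 2 (volume.restrict (ball 0 R)))
    (hv : MemLp v 2 (volume.restrict (ball 0 R))) :
    MemLp (gradOf k n u v) 2 (volume.restrict (ball 0 R)) :=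
  (memLp_top_smul memLp_top_sqrt hv).add (memLp_mul_smul_radialDir hn hu)

/-- The multipliers in `gradOf` are bounded on the ball and can be moved onto `h`, which leaves two
`L²` pairings. -/
theorem continuous_integral_inner_gradOf (hn : MemLp n ⊤ volume) {h : E d → V d}
    (hh : MemLp h 2 (volume.restrict (ball 0 R))) :
    Continuous fun p : Lp ℂ 2 ((volume : Measure (E d)).restrict (ball 0 R)) ×
        Lp (V d) 2 ((volume : Measure (E d)).restrict (ball 0 R)) =>
      ∫ x in ball 0 R, inner ℂ (h x) (gradOf k n p.1 p.2 x) := by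
  have h1 : MemLp (fun x => ((√(1 + ‖x‖) : ℝ) : ℂ) • h x) 2 (volume.restrict (ball 0 R)) :=
    memLp_top_smul memLp_top_sqrt hh
  have h2 : MemLp (fun x => starRingEnd ℂ
      (Complex.I * (k : ℂ) * (n x : ℂ) * inner ℂ (h x) (radialDir x)))
      2 (volume.restrict (ball 0 R)) := by
    have h3 : MemLp (fun x => (inner ℂ (h x) (radialDir x) : ℂ)) 2
        (volume.restrict (ball 0 R)) := by
      refine hh.of_le (hh.1.inner measurable_radialDir.aestronglyMeasurable)
        (Eventually.of_forall fun x => (norm_inner_le_norm _ _).trans ?_)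
      exact mul_le_of_le_one_right (norm_nonneg _) (norm_radialDir_le x)
    have h4 := (memLp_top_smul (memLp_ofReal_top hn) h3).const_mul (Complex.I * (k : ℂ))
    refine h4.star.ae_eq (Eventually.of_forall fun x => ?_)
    simp [mul_assoc]
  have e : ∀ p : Lp ℂ 2 ((volume : Measure (E d)).restrict (ball 0 R)) ×
      Lp (V d) 2 ((volume : Measure (E d)).restrict (ball 0 R)),
      ∫ x in ball 0 R, inner ℂ (h x) (gradOf k n p.1 p.2 x)
      = (∫ x in ball 0 R, inner ℂ (((√(1 + ‖x‖) : ℝ) : ℂ) • h x) (p.2 x))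
        + ∫ x in ball 0 R, inner ℂ (starRingEnd ℂ
          (Complex.I * (k : ℂ) * (n x : ℂ) * inner ℂ (h x) (radialDir x))) (p.1 x) := by
    intro p
    rw [← integral_add (integrable_inner_of_memLp h1 (Lp.memLp p.2))
      (integrable_inner_of_memLp h2 (Lp.memLp p.1))]
    refine integral_congr_ae (Eventually.of_forall fun x => ?_)
    simp only [gradOf, inner_add_right, inner_smul_right, inner_smul_left, Complex.conj_ofReal,
      RCLike.inner_apply, Complex.conj_conj]
    ring
  simp_rw [e]
  exact ((continuous_integral_inner_Lp h1).comp continuous_snd).add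
    ((continuous_integral_inner_Lp h2).comp continuous_fst)

/-- The `H¹` solutions in the ball `B_R`, as pairs formed by the function and the integrand of its
radiation seminorm, in `L²`. -/
def solLp {d : ℕ} (k : ℝ) (n : E d → ℝ) (F : (E d → ℂ) → ℂ) (R : ℝ) :
    Set (Lp ℂ 2 ((volume : Measure (E d)).restrict (ball 0 R)) ×
      Lp (V d) 2 ((volume : Measure (E d)).restrict (ball 0 R))) :=
  {p | IsSolPair k n F (ball 0 R) p.1 (gradOf k n p.1 p.2)}

/-- For each fixed test function, the gradient identity and the weak equation are equalities between
continuous functions of the pair. -/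
theorem isClosed_solLp (hn : MemLp n ⊤ volume) : IsClosed (solLp k n F R) := by
  have e : solLp k n F R = {p | (∀ φ : E d → ℝ, ContDiff ℝ ∞ φ → HasCompactSupport φ →
      tsupport φ ⊆ ball 0 R → ∀ i : Fin d,
        ∫ x in ball 0 R, inner ℂ ((fderiv ℝ φ x (EuclideanSpace.single i 1) : ℝ) : ℂ) (p.1 x)
          = - ∫ x in ball 0 R, inner ℂ ((φ x : ℂ) • (EuclideanSpace.single i 1 : V d))
            (gradOf k n p.1 p.2 x)) ∧
      ∀ φ : E d → ℂ, ContDiff ℝ 1 φ → HasCompactSupport φ → tsupport φ ⊆ ball 0 R →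
        -(∫ x in ball 0 R, inner ℂ (grad φ x) (gradOf k n p.1 p.2 x))
          + (k : ℂ) ^ 2 * ∫ x in ball 0 R, inner ℂ ((n x : ℂ) ^ 2 * φ x) (p.1 x) = F φ} := by
    ext p
    simp only [← ofReal_mul_eq_inner, ← ofReal_mul_apply_eq_inner, ← sq_mul_mul_conj_eq_inner]
    exact ⟨fun h => ⟨h.integral_eq, h.weakForm_eq⟩,
      fun h => ⟨⟨Lp.memLp p.1, memLp_gradOf hn (Lp.memLp p.1) (Lp.memLp p.2), h.1⟩, h.2⟩⟩
  rw [e, Set.ofPred_and]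
  refine IsClosed.inter ?_ ?_
  · simp only [Set.ofPred_forall]
    refine isClosed_iInter fun φ => isClosed_iInter fun a => isClosed_iInter fun b =>
      isClosed_iInter fun c => isClosed_iInter fun i => isClosed_eq ?_ ?_
    · exact (continuous_integral_inner_Lp (memLp_fderiv_single a b i)).comp continuous_fst
    · exact (continuous_integral_inner_gradOf hn (memLp_smul_single a b i)).neg
  · simp only [Set.ofPred_forall]
    refine isClosed_iInter fun φ => isClosed_iInter fun a => isClosed_iInter fun b =>
      isClosed_iInter fun c => isClosed_eq ?_ continuous_const
    exact (continuous_integral_inner_gradOf hn (memLp_grad a b)).neg.add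
      (continuous_const.mul ((continuous_integral_inner_Lp
        (memLp_sq_mul hn (memLp_of_continuous a.continuous b 2))).comp continuous_fst))

/-- The pair in `L²` defined by a solution. -/
noncomputable def IsSolPair.toLp (hu : IsSolPair k n F (ball 0 R) u g) (hn : MemLp n ⊤ volume) :
    Lp ℂ 2 ((volume : Measure (E d)).restrict (ball 0 R)) ×
      Lp (V d) 2 ((volume : Measure (E d)).restrict (ball 0 R)) :=
  (hu.memLp.toLp u,
    (memLp_radField (k := k) hn hu.memLp hu.memLp_grad).toLp (radField k n u g))

theorem gradOf_congr {μ : Measure (E d)} {u' : E d → ℂ} {v' : E d → V d} (h1 : u =ᵐ[μ] u')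
    (h2 : v =ᵐ[μ] v') : gradOf k n u v =ᵐ[μ] gradOf k n u' v' := by
  filter_upwards [h1, h2] with x e1 e2
  rw [gradOf, gradOf, e1, e2]

theorem IsSolPair.toLp_mem (hu : IsSolPair k n F (ball 0 R) u g) (hn : MemLp n ⊤ volume) :
    hu.toLp hn ∈ solLp k n F R := by
  refine IsSolPair.congr hu (MemLp.coeFn_toLp hu.memLp).symm ?_
  have h := gradOf_congr (k := k) (n := n) (hu.memLp.coeFn_toLp)
    (memLp_radField (k := k) hn hu.memLp hu.memLp_grad).coeFn_toLp
  rw [gradOf_radField] at h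
  exact h.symm

theorem combo_mem_solLp {G : (E d → ℂ) → ℂ} (hn : MemLp n ⊤ volume) {p q} (hp : p ∈ solLp k n F R)
    (hq : q ∈ solLp k n G R) (s t : ℂ) :
    s • p + t • q ∈ solLp k n (fun φ => s * F φ + t * G φ) R := by
  have hc := IsSolPair.combo hn hp hq s t
  have e1 : ⇑(s • p + t • q).1 =ᵐ[volume.restrict (ball 0 R)] fun x => s • p.1 x + t • q.1 x := by
    filter_upwards [Lp.coeFn_add (s • p.1) (t • q.1), Lp.coeFn_smul s p.1, Lp.coeFn_smul t q.1]
      with x a b c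
    rw [Prod.fst_add, Prod.smul_fst, Prod.smul_fst, a, Pi.add_apply, b, c]
    rfl
  have e2 : ⇑(s • p + t • q).2 =ᵐ[volume.restrict (ball 0 R)] fun x => s • p.2 x + t • q.2 x := by
    filter_upwards [Lp.coeFn_add (s • p.2) (t • q.2), Lp.coeFn_smul s p.2, Lp.coeFn_smul t q.2]
      with x a b c
    rw [Prod.snd_add, Prod.smul_snd, Prod.smul_snd, a, Pi.add_apply, b, c]
    rfl
  refine hc.congr e1.symm ((gradOf_congr e1 e2).trans (Eventually.of_forall fun x => ?_)).symm
  ext i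
  simp [gradOf]
  ring

theorem midpoint_mem_solLp (hn : MemLp n ⊤ volume) {p q} (hp : p ∈ solLp k n F R)
    (hq : q ∈ solLp k n F R) : (1 / 2 : ℂ) • p + (1 / 2 : ℂ) • q ∈ solLp k n F R := by
  have h := combo_mem_solLp hn hp hq (1 / 2) (1 / 2)
  have e : (fun φ => 1 / 2 * F φ + 1 / 2 * F φ) = F := by
    funext φ
    ring
  rwa [e] at h

theorem radSeminorm_of_mem_solLp {p} (hp : p ∈ solLp k n F R) :
    radSeminorm k n (ball 0 R) p.1 = ‖p.2‖ₑ := by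
  rw [radSeminorm_eq isOpen_ball (IsSolPair.toIsH1Pair hp).hasWeakGradOn, radField_gradOf,
    Lp.enorm_def]

theorem IsSolPair.radSeminorm_eq (hu : IsSolPair k n F (ball 0 R) u g) (hn : MemLp n ⊤ volume) :
    radSeminorm k n (ball 0 R) u = ‖(hu.toLp hn).2‖ₑ := by
  rw [Helmholtz.radSeminorm_eq isOpen_ball hu.hasWeakGradOn]
  exact (Lp.enorm_toLp (memLp_radField hn hu.memLp hu.memLp_grad)).symm

/-- The parallelogram law, with the lower bound `m` applied at the midpoint, which is again a
solution. Existence, uniqueness and convergence of minimizers all rest on this inequality. -/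
theorem norm_sub_sq_le_of_mem_solLp (hn : MemLp n ⊤ volume) {m : ℝ} (hm : 0 ≤ m)
    (hmin : ∀ p ∈ solLp k n F R, m ≤ ‖p.2‖) {p q} (hp : p ∈ solLp k n F R)
    (hq : q ∈ solLp k n F R) : ‖p.2 - q.2‖ ^ 2 ≤ 2 * (‖p.2‖ ^ 2 + ‖q.2‖ ^ 2) - 4 * m ^ 2 := by
  have h1 := hmin _ (midpoint_mem_solLp hn hp hq)
  rw [Prod.snd_add, Prod.smul_snd, Prod.smul_snd, ← smul_add, norm_smul] at h1
  have h2 := parallelogram_law_with_norm ℂ p.2 q.2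
  have h3 : 2 * m ≤ ‖p.2 + q.2‖ := by
    norm_num at h1
    linarith
  nlinarith [mul_self_le_mul_self (by positivity) h3]

variable [Nonempty (Fin d)] {nstar : ℝ}

/-- The difference of two solutions is homogeneous, so coercivity bounds its first component by its
second. The product carries the maximum norm, whence `C + 1`. -/
theorem exists_coercivity_bound_solLp (hk : 0 < k) (hn : MemLp n ⊤ volume)
    (hns : 0 < nstar) (hnlow : ∀ᵐ x, nstar ≤ n x)
    (hsmall : eLpNorm (fun x => 1 - sphereMean n ‖x‖ / n x) ⊤ volume < 1) (hR : 0 < R) :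
    ∃ C : ℝ, 0 < C ∧ ∀ F : (E d → ℂ) → ℂ, ∀ p ∈ solLp k n F R, ∀ q ∈ solLp k n F R,
      ‖p - q‖ ≤ C * ‖p.2 - q.2‖ := by
  obtain ⟨C, hC, h⟩ := exists_coercivity_bound hk hn hns hnlow hsmall hR
  refine ⟨C + 1, by positivity, fun F p hp q hq => ?_⟩
  have hpq : p - q ∈ solLp k n (fun _ => 0) R := by
    have := combo_mem_solLp hn hp hq 1 (-1)
    simpa [sub_eq_add_neg] using this
  have h1 := h _ _ hpq
  rw [radField_gradOf, ← Lp.enorm_def, ← Lp.enorm_def, ← ofReal_norm, ← ofReal_norm,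
    ← ENNReal.ofReal_mul hC.le, ENNReal.ofReal_le_ofReal_iff (by positivity)] at h1
  rw [Prod.fst_sub, Prod.snd_sub] at h1
  rw [Prod.norm_def, Prod.fst_sub, Prod.snd_sub]
  refine max_le (h1.trans ?_) ?_
  · gcongr
    linarith
  · nlinarith [norm_nonneg (p.2 - q.2)]

/-- A net of solutions whose radiation integrands satisfy a Cauchy estimate converges. -/
theorem exists_tendsto_solLp {ι : Type*} [Nonempty ι] [SemilatticeSup ι] (hk : 0 < k)
    (hn : MemLp n ⊤ volume) (hns : 0 < nstar) (hnlow : ∀ᵐ x, nstar ≤ n x)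
    (hsmall : eLpNorm (fun x => 1 - sphereMean n ‖x‖ / n x) ⊤ volume < 1) (hR : 0 < R)
    {p : ι → _} (hp : ∀ i, p i ∈ solLp k n F R) {b : ι → ℝ} (hb : Tendsto b atTop (𝓝 0))
    (hpb : ∀ i j, i ≤ j → ‖(p i).2 - (p j).2‖ ^ 2 ≤ b i) :
    ∃ q ∈ solLp k n F R, Tendsto p atTop (𝓝 q) := by
  obtain ⟨C, hC, hco⟩ := exists_coercivity_bound_solLp hk hn hns hnlow hsmall hR
  have hcau : CauchySeq p := by
    refine cauchySeq_of_le_tendsto_0' (fun i => C * √(b i)) (fun i j hij => ?_) ?_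
    · rw [dist_eq_norm]
      refine (hco F _ (hp i) _ (hp j)).trans ?_
      gcongr
      exact Real.le_sqrt_of_sq_le (hpb i j hij)
    · simpa using ((Real.continuous_sqrt.tendsto 0).comp hb).const_mul C
  obtain ⟨q, hq⟩ := cauchySeq_tendsto_of_complete hcau
  exact ⟨q, (isClosed_solLp hn).mem_of_tendsto hq (Eventually.of_forall hp), hq⟩

theorem exists_minimizer_solLp (hk : 0 < k)
    (hn : MemLp n ⊤ volume) (hns : 0 < nstar) (hnlow : ∀ᵐ x, nstar ≤ n x)
    (hsmall : eLpNorm (fun x => 1 - sphereMean n ‖x‖ / n x) ⊤ volume < 1) (hR : 0 < R)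
    (hne : (solLp k n F R).Nonempty) :
    ∃ p ∈ solLp k n F R, ∀ q ∈ solLp k n F R, ‖p.2‖ ≤ ‖q.2‖ := by
  set S : Set ℝ := (fun p => ‖p.2‖) '' solLp k n F R with hS
  have hbdd : BddBelow S := ⟨0, by rintro _ ⟨p, -, rfl⟩; exact norm_nonneg _⟩
  have hm0 : 0 ≤ sInf S := Real.sInf_nonneg (by rintro _ ⟨p, -, rfl⟩; exact norm_nonneg _)
  have hmin : ∀ p ∈ solLp k n F R, sInf S ≤ ‖p.2‖ := fun p hp =>
    csInf_le hbdd ⟨p, hp, rfl⟩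
  obtain ⟨s, hanti, hs, hsS⟩ := exists_seq_tendsto_sInf (hne.image _) hbdd
  choose p hp hps using hsS
  simp only at hps
  -- For `i ≤ j` the minimizing values satisfy `s j ≤ s i`, so `2 (s i² + s j²) - 4 inf²` is at most
  -- `4 (s i² - inf²)`.
  have hb : Tendsto (fun j => 4 * (s j ^ 2 - sInf S ^ 2)) atTop (𝓝 0) := by
    have := ((hs.pow 2).sub_const (sInf S ^ 2)).const_mul 4
    rwa [← hS, sub_self, mul_zero] at this
  obtain ⟨q, hq, hlim⟩ := exists_tendsto_solLp hk hn hns hnlow hsmall hR hp hb fun i j hij => by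
    refine (norm_sub_sq_le_of_mem_solLp hn hm0 hmin (hp i) (hp j)).trans ?_
    have h1 : s j ^ 2 ≤ s i ^ 2 := by
      have : 0 ≤ s j := hps j ▸ norm_nonneg _
      exact pow_le_pow_left₀ this (hanti hij) 2
    rw [hps, hps]
    linarith
  refine ⟨q, hq, fun r hr => ?_⟩
  have h1 : Tendsto s atTop (𝓝 ‖q.2‖) := by
    have := ((continuous_norm.comp continuous_snd).tendsto q).comp hlim
    refine this.congr fun j => hps j
  rw [tendsto_nhds_unique h1 hs]
  exact hmin r hr

end Closed

/-! ### From growing balls to the whole space -/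

section Glue

variable {d : ℕ} {X : Type*} {Ω : Set (E d)} {u v W : E d → ℂ} {g h : E d → V d} {k : ℝ}
  {n : E d → ℝ} {R : ℝ} {f : E d → ℂ}

theorem ball_natCast_subset {M N : ℕ} (h : M ≤ N) :
    ball (0 : E d) ((M : ℝ) + 1) ⊆ ball 0 ((N : ℝ) + 1) :=
  ball_subset_ball (by gcongr)

theorem iUnion_ball_natCast : ⋃ N : ℕ, ball (0 : E d) ((N : ℝ) + 1) = Set.univ := by
  refine Set.eq_univ_of_forall fun x => Set.mem_iUnion.2 ⟨⌊‖x‖⌋₊, ?_⟩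
  rw [mem_ball_zero_iff]
  exact Nat.lt_floor_add_one _

theorem exists_ball_natCast_supset {s : Set (E d)} (hs : IsCompact s) :
    ∃ N : ℕ, s ⊆ ball 0 ((N : ℝ) + 1) := by
  obtain ⟨r, hr⟩ := hs.isBounded.subset_ball 0
  obtain ⟨N, hN⟩ := exists_nat_ge r
  exact ⟨N, hr.trans (ball_subset_ball (by linarith))⟩

/-- Functions on growing balls that agree almost everywhere can be glued. -/
theorem exists_glue {F : ℕ → E d → X}
    (hF : ∀ M N : ℕ, M ≤ N → F N =ᵐ[volume.restrict (ball 0 ((M : ℝ) + 1))] F M) :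
    ∃ G : E d → X, ∀ N : ℕ, G =ᵐ[volume.restrict (ball 0 ((N : ℝ) + 1))] F N := by
  -- `⌊‖x‖⌋₊` is the least index `N` for which the open ball of radius `N + 1` contains `x`.
  refine ⟨fun x => F ⌊‖x‖⌋₊ x, fun N => ?_⟩
  have h : ∀ᵐ x : E d, ∀ M : ℕ, M ≤ N → x ∈ ball (0 : E d) ((M : ℝ) + 1) → F N x = F M x := by
    refine ae_all_iff.2 fun M => ?_
    by_cases hMN : M ≤ N
    · filter_upwards [(ae_restrict_iff' measurableSet_ball).1 (hF M N hMN)] with x hx _ hxM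
      exact hx hxM
    · exact Eventually.of_forall fun x h => absurd h hMN
  rw [EventuallyEq, ae_restrict_iff' measurableSet_ball]
  filter_upwards [h] with x hx hxN
  rw [mem_ball_zero_iff] at hxN
  have h1 : ⌊‖x‖⌋₊ ≤ N := by
    have := (Nat.floor_lt (norm_nonneg x) (n := N + 1)).2 (by exact_mod_cast hxN)
    omega
  exact (hx _ h1 (mem_ball_zero_iff.2 (Nat.lt_floor_add_one _))).symm

/-- Gradients on nested balls agree by uniqueness, hence glue; every test function lives in a single
ball. -/
theorem exists_hasWeakGradOn_univ
    (h : ∀ N : ℕ, ∃ g, IsH1Pair (ball 0 ((N : ℝ) + 1)) u g) :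
    ∃ g, HasWeakGradOn Set.univ u g ∧ ∀ N : ℕ, IsH1Pair (ball 0 ((N : ℝ) + 1)) u g := by
  choose G hG using h
  obtain ⟨g, hg⟩ := exists_glue (F := G) fun M N hMN =>
    ((hG N).mono (ball_natCast_subset hMN)).hasWeakGradOn.ae_eq isOpen_ball (hG M).hasWeakGradOn
  have hp : ∀ N : ℕ, IsH1Pair (ball 0 ((N : ℝ) + 1)) u g := fun N =>
    (hG N).congr (EventuallyEq.refl _ _) (hg N).symm
  refine ⟨g, ⟨?_, ?_, fun φ a b c i => ?_⟩, hp⟩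
  · rw [locallyIntegrableOn_univ]
    intro x
    obtain ⟨N, hN⟩ := exists_ball_natCast_supset (isCompact_singleton (x := x))
    have h1 := (hp N).hasWeakGradOn.1 x (hN rfl)
    rwa [isOpen_ball.nhdsWithin_eq (hN rfl)] at h1
  · rw [locallyIntegrableOn_univ]
    intro x
    obtain ⟨N, hN⟩ := exists_ball_natCast_supset (isCompact_singleton (x := x))
    have h1 := (hp N).hasWeakGradOn.2.1 x (hN rfl)
    rwa [isOpen_ball.nhdsWithin_eq (hN rfl)] at h1
  · obtain ⟨N, hN⟩ := exists_ball_natCast_supset b.isCompact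
    have h1 := (hp N).integral_eq φ a b hN i
    rwa [setIntegral_eq_of_tsupport_subset (Set.subset_univ (ball 0 ((N : ℝ) + 1))) fun x hx => ?_,
      setIntegral_eq_of_tsupport_subset (Set.subset_univ (ball 0 ((N : ℝ) + 1))) fun x hx => ?_]
    · simp [eq_zero_of_notMem hN hx]
    · have : fderiv ℝ φ x = 0 :=
        image_eq_zero_of_notMem_tsupport fun h => hx (hN (tsupport_fderiv_subset ℝ h))
      simp [this]

theorem lintegral_enorm_sq {α Y : Type*} [MeasurableSpace α] {μ : Measure α}
    [NormedAddCommGroup Y] (F : α → Y) : ∫⁻ x, ‖F x‖ₑ ^ 2 ∂μ = eLpNorm F 2 μ ^ 2 := by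
  rw [eLpNorm_eq_lintegral_rpow_enorm_toReal two_ne_zero ENNReal.ofNat_ne_top,
    ← ENNReal.rpow_two, ← ENNReal.rpow_mul]
  simp

theorem eLpNorm_univ_le {Y : Type*} [NormedAddCommGroup Y] {F : E d → Y} {B : ℝ≥0∞}
    (h : ∀ N : ℕ, eLpNorm F 2 (volume.restrict (ball 0 ((N : ℝ) + 1))) ≤ B) :
    eLpNorm F 2 (volume.restrict Set.univ) ≤ B := by
  rw [← ENNReal.pow_le_pow_left_iff two_ne_zero, ← lintegral_enorm_sq, ← iUnion_ball_natCast,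
    setLIntegral_iUnion_of_directed _ (monotone_nat_of_le_succ fun N =>
      ball_natCast_subset N.le_succ).directed_le]
  refine iSup_le fun N => ?_
  rw [lintegral_enorm_sq]
  gcongr
  exact h N

/-- The equation is local, and a bound on the radiation seminorm that is uniform over the balls
passes to the whole space by monotone convergence. -/
theorem isOutgoing_of_forall_ball {B : ℝ≥0∞} (hB : B ≠ ⊤)
    (h : ∀ N : ℕ, ∃ g, IsSolPair k n (rhs f) (ball 0 ((N : ℝ) + 1)) W g ∧
      eLpNorm (radField k n W g) 2 (volume.restrict (ball 0 ((N : ℝ) + 1))) ≤ B) :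
    IsOutgoing k n f W := by
  obtain ⟨g, hg, hgN⟩ := exists_hasWeakGradOn_univ fun N => by
    obtain ⟨g, hg, -⟩ := h N
    exact ⟨g, hg.toIsH1Pair⟩
  have hs : ∀ N : ℕ, IsSolPair k n (rhs f) (ball 0 ((N : ℝ) + 1)) W g ∧
      eLpNorm (radField k n W g) 2 (volume.restrict (ball 0 ((N : ℝ) + 1))) ≤ B := fun N => by
    obtain ⟨g', hg', hb⟩ := h N
    have e := hg'.hasWeakGradOn.ae_eq isOpen_ball (hgN N).hasWeakGradOn
    refine ⟨hg'.congr (EventuallyEq.refl _ _) e, le_trans (le_of_eq (eLpNorm_congr_ae ?_)) hb⟩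
    filter_upwards [e] with x hx
    rw [radField, radField, hx]
  refine ⟨fun R _ => ?_, fun φ a b c => ?_, ?_⟩
  · obtain ⟨N, hN⟩ := exists_nat_ge R
    exact ((hgN N).mono (ball_subset_ball (by linarith))).memH1
  · obtain ⟨N, hN⟩ := exists_ball_natCast_supset b.isCompact
    rw [setIntegral_mul_conj_eq_rhs f c, ← (hs N).1.weakForm_eq φ a b hN,
      ← weakForm_mono (Set.subset_univ _) hN]
    exact weakForm_congr (EventuallyEq.refl _ _) (hg.weakGrad_ae_eq isOpen_univ)
  · rw [radSeminorm_eq isOpen_univ hg]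
    exact (eLpNorm_univ_le fun N => (hs N).2).trans_lt hB.lt_top

theorem IsOutgoing.exists_isSolPair (hU : IsOutgoing k n f u) :
    ∃ g, ∀ R : ℝ, 0 < R → IsSolPair k n (rhs f) (ball 0 R) u g ∧
      eLpNorm (radField k n u g) 2 (volume.restrict (ball 0 R)) ≤ radSeminorm k n Set.univ u := by
  obtain ⟨g, hg, hgN⟩ := exists_hasWeakGradOn_univ fun N =>
    ⟨_, (hU.1 ((N : ℝ) + 1) (by positivity)).isH1Pair isOpen_ball⟩
  refine ⟨g, fun R _ => ⟨⟨?_, fun φ a b c => ?_⟩, ?_⟩⟩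
  · obtain ⟨N, hN⟩ := exists_nat_ge R
    exact (hgN N).mono (ball_subset_ball (by linarith))
  · rw [← setIntegral_mul_conj_eq_rhs f (Set.subset_univ (tsupport φ)),
      ← hU.2.1 φ a b (Set.subset_univ _), ← weakForm_mono (Set.subset_univ _) c]
    exact weakForm_congr (EventuallyEq.refl _ _) (hg.weakGrad_ae_eq isOpen_univ).symm
  · rw [radSeminorm_eq isOpen_univ hg]
    exact eLpNorm_mono_measure _ (Measure.restrict_mono_set _ (Set.subset_univ _))

theorem h1Norm_eq (hΩ : IsOpen Ω) (hu : IsH1Pair Ω u g) :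
    h1Norm Ω u = (eLpNorm u 2 (volume.restrict Ω) ^ 2 +
      eLpNorm g 2 (volume.restrict Ω) ^ 2) ^ (1 / 2 : ℝ) := by
  rw [h1Norm, if_pos hu.memH1, lintegral_add_left' (hu.memLp.1.enorm.pow_const 2),
    lintegral_enorm_sq, lintegral_enorm_sq,
    eLpNorm_congr_ae (hu.hasWeakGradOn.weakGrad_ae_eq hΩ)]

/-- This turns `L²` convergence of functions and radiation fields into `H¹` convergence. The
constants are the sup norms on the ball of `√(1 + |x|)` and of `ikn`. -/
theorem exists_eLpNorm_gradOf_le (k : ℝ) (hn : MemLp n ⊤ volume) (R : ℝ) :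
    ∃ a b : ℝ≥0∞, a ≠ ⊤ ∧ b ≠ ⊤ ∧ ∀ (u : E d → ℂ) (v : E d → V d),
      MemLp u 2 (volume.restrict (ball 0 R)) → MemLp v 2 (volume.restrict (ball 0 R)) →
        eLpNorm (gradOf k n u v) 2 (volume.restrict (ball 0 R))
          ≤ a * eLpNorm v 2 (volume.restrict (ball 0 R))
            + b * eLpNorm u 2 (volume.restrict (ball 0 R)) := by
  have hc : MemLp (fun x => Complex.I * (k : ℂ) * (n x : ℂ)) ⊤ (volume.restrict (ball 0 R)) :=
    (memLp_ofReal_top hn).const_mul _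
  have hs : MemLp (fun x : E d => ((√(1 + ‖x‖) : ℝ) : ℂ)) ⊤ (volume.restrict (ball 0 R)) :=
    memLp_top_sqrt
  refine ⟨_, _, hs.2.ne, hc.2.ne, fun u v hu hv => ?_⟩
  have h1 : eLpNorm (fun x => ((√(1 + ‖x‖) : ℝ) : ℂ) • v x) 2 (volume.restrict (ball 0 R)) ≤ _ :=
    eLpNorm_smul_le_eLpNorm_top_mul_eLpNorm 2 hv.1 (fun x : E d => ((√(1 + ‖x‖) : ℝ) : ℂ))
  have h2 : eLpNorm (fun x => (Complex.I * (k : ℂ) * (n x : ℂ)) • u x) 2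
      (volume.restrict (ball 0 R)) ≤ _ :=
    eLpNorm_smul_le_eLpNorm_top_mul_eLpNorm 2 hu.1 (fun x => Complex.I * (k : ℂ) * (n x : ℂ))
  have h3 : eLpNorm (fun x => (Complex.I * (k : ℂ) * (n x : ℂ) * u x) • (radialDir x : V d)) 2
      (volume.restrict (ball 0 R))
      ≤ eLpNorm (fun x => (Complex.I * (k : ℂ) * (n x : ℂ)) • u x) 2
        (volume.restrict (ball 0 R)) := eLpNorm_mono fun x => by
    rw [norm_smul, smul_eq_mul]
    exact mul_le_of_le_one_right (norm_nonneg _) (norm_radialDir_le x)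
  exact (eLpNorm_add_le (memLp_top_smul hs hv).1
    (memLp_mul_smul_radialDir hn hu).1 one_le_two).trans (add_le_add h1 (h3.trans h2))

theorem gradOf_sub (u u' : E d → ℂ) (v v' : E d → V d) :
    gradOf k n (u - u') (v - v') = gradOf k n u v - gradOf k n u' v' := by
  funext x
  ext i
  simp [gradOf]
  ring

end Glue

/-! ### Minimizers and their limit -/

section Minimizers

variable {d : ℕ} {u v : E d → ℂ} {g h : E d → V d} {k : ℝ} {n : E d → ℝ} {R S : ℝ}
  {f : E d → ℂ} {F : (E d → ℂ) → ℂ} {nstar : ℝ}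

theorem norm_toLp_snd (hn : MemLp n ⊤ volume) (hu : IsSolPair k n F (ball 0 R) u g) :
    ‖(hu.toLp hn).2‖
      = (eLpNorm (radField k n u g) 2 (volume.restrict (ball 0 R))).toReal :=
  Lp.norm_toLp _ (memLp_radField hn hu.memLp hu.memLp_grad)

theorem norm_toLp_sub_snd (hn : MemLp n ⊤ volume) (hu : IsSolPair k n F (ball 0 R) u g)
    (hv : IsSolPair k n F (ball 0 R) v h) :
    ‖(hu.toLp hn).2 - (hv.toLp hn).2‖ = (eLpNorm (radField k n u g - radField k n v h) 2
      (volume.restrict (ball 0 R))).toReal := by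
  have hu' := memLp_radField (k := k) hn hu.memLp hu.memLp_grad
  have hv' := memLp_radField (k := k) hn hv.memLp hv.memLp_grad
  exact (congrArg norm (MemLp.toLp_sub hu' hv')).symm.trans (Lp.norm_toLp _ (hu'.sub hv'))

theorem norm_toLp_mono_snd_le (hn : MemLp n ⊤ volume) (hu : IsSolPair k n F (ball 0 R) u g)
    (hSR : S ≤ R) :
    ‖((hu.mono (ball_subset_ball hSR)).toLp hn).2‖ ≤ ‖(hu.toLp hn).2‖ := by
  rw [norm_toLp_snd, norm_toLp_snd]
  exact ENNReal.toReal_mono (memLp_radField hn hu.memLp hu.memLp_grad).2.ne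
    (eLpNorm_mono_measure _ (Measure.restrict_mono_set _ (ball_subset_ball hSR)))

theorem norm_toLp_mono_sub_snd_le (hn : MemLp n ⊤ volume) (hu : IsSolPair k n F (ball 0 R) u g)
    (hv : IsSolPair k n F (ball 0 R) v h) (hSR : S ≤ R) :
    ‖((hu.mono (ball_subset_ball hSR)).toLp hn).2 - ((hv.mono (ball_subset_ball hSR)).toLp hn).2‖
      ≤ ‖(hu.toLp hn).2 - (hv.toLp hn).2‖ := by
  rw [norm_toLp_sub_snd, norm_toLp_sub_snd]
  exact ENNReal.toReal_mono ((memLp_radField hn hu.memLp hu.memLp_grad).sub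
    (memLp_radField hn hv.memLp hv.memLp_grad)).2.ne
    (eLpNorm_mono_measure _ (Measure.restrict_mono_set _ (ball_subset_ball hSR)))

theorem IsMinimizer.norm_le (hn : MemLp n ⊤ volume) (hu : IsMinimizer k n f R u)
    (hg : IsSolPair k n (rhs f) (ball 0 R) u g) {p} (hp : p ∈ solLp k n (rhs f) R) :
    ‖(hg.toLp hn).2‖ ≤ ‖p.2‖ := by
  have h1 : radSeminorm k n (ball 0 R) u ≤ radSeminorm k n (ball 0 R) p.1 :=
    hu.2 (mem_solutionSet_iff.2 ⟨_, hp⟩)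
  rwa [hg.radSeminorm_eq hn, radSeminorm_of_mem_solLp hp, enorm_le_iff_norm_le] at h1

/-- Two minimizers have the same seminorm, so the parallelogram inequality makes their radiation
fields equal, and coercivity then identifies the functions. -/
theorem existsUnique_isMinimizer [Nonempty (Fin d)] (hk : 0 < k)
    (hn : MemLp n ⊤ volume) (hns : 0 < nstar) (hnlow : ∀ᵐ x, nstar ≤ n x)
    (hsmall : eLpNorm (fun x => 1 - sphereMean n ‖x‖ / n x) ⊤ volume < 1) (hR : 0 < R)
    (hne : IsSolPair k n (rhs f) (ball 0 R) v h) :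
    ∃ u : E d → ℂ, IsMinimizer k n f R u ∧
      ∀ v : E d → ℂ, IsMinimizer k n f R v → v =ᵐ[volume.restrict (ball 0 R)] u := by
  obtain ⟨p, hp, hmin⟩ := exists_minimizer_solLp hk hn hns hnlow hsmall hR
    ⟨_, hne.toLp_mem hn⟩
  refine ⟨p.1, ⟨mem_solutionSet_iff.2 ⟨_, hp⟩, fun w hw => ?_⟩, fun w hw => ?_⟩
  · obtain ⟨q, hq⟩ := mem_solutionSet_iff.1 hw
    change radSeminorm k n (ball 0 R) p.1 ≤ radSeminorm k n (ball 0 R) w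
    rw [hq.radSeminorm_eq hn, radSeminorm_of_mem_solLp hp, enorm_le_iff_norm_le]
    exact hmin _ (hq.toLp_mem hn)
  · obtain ⟨q, hq⟩ := mem_solutionSet_iff.1 hw.1
    have hqm := hq.toLp_mem hn
    have h1 : ‖(hq.toLp hn).2‖ = ‖p.2‖ :=
      le_antisymm (hw.norm_le hn hq hp) (hmin _ hqm)
    have h2 := norm_sub_sq_le_of_mem_solLp hn (norm_nonneg p.2) hmin hqm hp
    obtain ⟨C, hC, hco⟩ := exists_coercivity_bound_solLp hk hn hns hnlow hsmall hR
    have h3 := hco _ _ hqm _ hp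
    have h4 : ‖(hq.toLp hn).2 - p.2‖ = 0 := by
      rw [h1] at h2
      exact pow_eq_zero_iff two_ne_zero |>.1 (le_antisymm (by linarith) (sq_nonneg _))
    rw [h4, mul_zero, norm_le_zero_iff, sub_eq_zero] at h3
    rw [← h3]
    exact (MemLp.coeFn_toLp hq.memLp).symm

/-- Minimizers in growing balls converge in every ball to a solution. -/
theorem exists_tendsto_minimizers [Nonempty (Fin d)] (hk : 0 < k)
    (hn : MemLp n ⊤ volume) (hns : 0 < nstar) (hnlow : ∀ᵐ x, nstar ≤ n x)
    (hsmall : eLpNorm (fun x => 1 - sphereMean n ‖x‖ / n x) ⊤ volume < 1)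
    {u : ℝ → E d → ℂ} (hu : ∀ R : ℝ, 0 < R → IsMinimizer k n f R (u R))
    {g : ℝ → E d → V d} (hg : ∀ R : ℝ, 0 < R → IsSolPair k n (rhs f) (ball 0 R) (u R) (g R))
    {B : ℝ} (hB : ∀ R (hR : 0 < R), ‖((hg R hR).toLp hn).2‖ ≤ B) (hR : 0 < R) :
    ∃ p ∈ solLp k n (rhs f) R, ‖p.2‖ ≤ B ∧
      Tendsto (fun t => eLpNorm (u t - ⇑p.1) 2 (volume.restrict (ball 0 R))) atTop (𝓝 0) ∧
      Tendsto (fun t => eLpNorm (radField k n (u t) (g t) - ⇑p.2) 2 (volume.restrict (ball 0 R)))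
        atTop (𝓝 0) := by
  -- Replacing `t` by `max R t` makes every minimizer in the family restrict to `B_R`; nothing
  -- changes for large `t`.
  have hpos : ∀ t, 0 < max R t := fun t => hR.trans_le (le_max_left _ _)
  set m : ℝ → ℝ := fun t => ‖((hg (max R t) (hpos t)).toLp hn).2‖ with hm
  have hle : ∀ s t, s ≤ t → max R s ≤ max R t := fun s t hst => max_le_max le_rfl hst
  -- The minimizer on the larger ball, restricted to the smaller one, is a competitor there.
  have hmono : Monotone m := fun s t hst =>
    ((hu _ (hpos s)).norm_le hn (hg _ (hpos s))
      (((hg _ (hpos t)).mono (ball_subset_ball (hle s t hst))).toLp_mem hn)).trans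
      (norm_toLp_mono_snd_le hn (hg _ (hpos t)) (hle s t hst))
  have hbdd : BddAbove (Set.range m) := ⟨B, by rintro _ ⟨t, rfl⟩; exact hB _ (hpos t)⟩
  have hlim := tendsto_atTop_ciSup hmono hbdd
  set L := ⨆ t, m t with hL
  let p : ℝ → _ := fun t => ((hg (max R t) (hpos t)).mono
    (ball_subset_ball (le_max_left R t))).toLp hn
  have hp : ∀ t, p t ∈ solLp k n (rhs f) R := fun t => IsSolPair.toLp_mem _ hn
  -- For `s ≤ t` the parallelogram bound on the ball of radius `max R s` is `2 (m s² + m t²) - 4 m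
  -- s²`, at most `2 (L² - m s²)`.
  have hb : Tendsto (fun t => 2 * (L ^ 2 - m t ^ 2)) atTop (𝓝 0) := by
    have := ((hlim.pow 2).const_sub (L ^ 2)).const_mul 2
    rwa [sub_self, mul_zero] at this
  obtain ⟨q, hq, hqlim⟩ := exists_tendsto_solLp hk hn hns hnlow hsmall hR hp hb fun s t hst => by
    have h1 := norm_toLp_mono_sub_snd_le hn (hg _ (hpos s))
      ((hg _ (hpos t)).mono (ball_subset_ball (hle s t hst))) (le_max_left R s)
    have h2 := norm_sub_sq_le_of_mem_solLp hn (norm_nonneg _)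
      (fun r hr => (hu _ (hpos s)).norm_le hn (hg _ (hpos s)) hr)
      ((hg _ (hpos s)).toLp_mem hn)
      (((hg _ (hpos t)).mono (ball_subset_ball (hle s t hst))).toLp_mem hn)
    have h3 := norm_toLp_mono_snd_le hn (hg _ (hpos t)) (hle s t hst)
    have h4 : m t ^ 2 ≤ L ^ 2 :=
      pow_le_pow_left₀ (norm_nonneg _) (le_ciSup hbdd t) 2
    have h5 := pow_le_pow_left₀ (norm_nonneg _) h1 2
    have h6 := pow_le_pow_left₀ (norm_nonneg _) h3 2
    simp only [hm] at h4 ⊢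
    refine h5.trans ?_
    linarith
  have hev : ∀ᶠ t in atTop, max R t = t := by
    filter_upwards [eventually_ge_atTop R] with t ht
    exact max_eq_right ht
  refine ⟨q, hq, ?_, ?_, ?_⟩
  · refine le_of_tendsto ((continuous_norm.comp continuous_snd).continuousAt.tendsto.comp hqlim)
      (Eventually.of_forall fun t => ?_)
    exact (norm_toLp_mono_snd_le hn (hg _ (hpos t)) (le_max_left R t)).trans (hB _ (hpos t))
  · have h1 := (Lp.tendsto_Lp_iff_tendsto_eLpNorm' _ _).1 ((continuous_fst.tendsto q).comp hqlim)
    refine h1.congr' ?_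
    filter_upwards [hev] with t ht
    refine eLpNorm_congr_ae ?_
    filter_upwards [((hg (max R t) (hpos t)).mono
      (ball_subset_ball (le_max_left R t))).memLp.coeFn_toLp] with x hx
    simp only [Pi.sub_apply]
    congr 1
    refine hx.trans ?_
    rw [ht]
  · have h1 := (Lp.tendsto_Lp_iff_tendsto_eLpNorm' _ _).1 ((continuous_snd.tendsto q).comp hqlim)
    refine h1.congr' ?_
    filter_upwards [hev] with t ht
    refine eLpNorm_congr_ae ?_
    have hs := (hg (max R t) (hpos t)).mono (ball_subset_ball (le_max_left R t))
    filter_upwards [(memLp_radField (k := k) hn hs.memLp hs.memLp_grad).coeFn_toLp] with x hx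
    simp only [Pi.sub_apply]
    congr 1
    refine hx.trans ?_
    rw [ht]

theorem ae_eq_of_tendsto_eLpNorm {α X : Type*} [MeasurableSpace α] {μ : Measure α}
    [NormedAddCommGroup X] {w : ℝ → α → X} {a b : α → X}
    (hw : ∀ᶠ t in atTop, AEStronglyMeasurable (w t) μ) (ha : AEStronglyMeasurable a μ)
    (hb : AEStronglyMeasurable b μ)
    (hwa : Tendsto (fun t => eLpNorm (w t - a) 2 μ) atTop (𝓝 0))
    (hwb : Tendsto (fun t => eLpNorm (w t - b) 2 μ) atTop (𝓝 0)) : a =ᵐ[μ] b := by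
  have h1 : eLpNorm (a - b) 2 μ ≤ 0 := by
    refine ge_of_tendsto (by simpa using hwa.add hwb) ?_
    filter_upwards [hw] with t ht
    rw [← eLpNorm_sub_comm a (w t)]
    refine le_trans (le_of_eq ?_) (eLpNorm_add_le (ha.sub ht) (ht.sub hb) one_le_two)
    rw [sub_add_sub_cancel]
  rw [nonpos_iff_eq_zero, eLpNorm_eq_zero_iff (ha.sub hb) two_ne_zero] at h1
  filter_upwards [h1] with x hx
  exact sub_eq_zero.1 hx

theorem tendsto_h1Norm_minimizers [Nonempty (Fin d)] (hk : 0 < k)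
    (hn : MemLp n ⊤ volume) (hns : 0 < nstar) (hnlow : ∀ᵐ x, nstar ≤ n x)
    (hsmall : eLpNorm (fun x => 1 - sphereMean n ‖x‖ / n x) ⊤ volume < 1)
    {U : E d → ℂ} (hU : IsOutgoing k n f U)
    (hUuniq : ∀ W : E d → ℂ, IsOutgoing k n f W → W =ᵐ[volume] U)
    {u : ℝ → E d → ℂ} (hu : ∀ R : ℝ, 0 < R → IsMinimizer k n f R (u R)) :
    Tendsto (fun t : ℝ => h1Norm (ball 0 R) (fun x => u t x - U x)) atTop (𝓝 0) := by
  obtain ⟨G, hG⟩ := hU.exists_isSolPair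
  set g : ℝ → E d → V d := fun t => weakGrad (ball 0 t) (u t)
  have hg : ∀ t : ℝ, 0 < t → IsSolPair k n (rhs f) (ball 0 t) (u t) (g t) := fun t ht =>
    (hu t ht).1.2.isSolPair ((hu t ht).1.1.isH1Pair isOpen_ball)
  -- The restriction of `U` competes in every ball, which bounds all minimal values at once.
  have hB : ∀ t (ht : 0 < t), ‖((hg t ht).toLp hn).2‖ ≤ (radSeminorm k n Set.univ U).toReal :=
    fun t ht => by
      refine ((hu t ht).norm_le hn (hg t ht) ((hG t ht).1.toLp_mem hn)).trans ?_
      rw [norm_toLp_snd]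
      exact ENNReal.toReal_mono hU.2.2.ne (hG t ht).2
  have hN : ∀ N : ℕ, (0 : ℝ) < (N : ℝ) + 1 := fun N => by positivity
  choose q hq hqB hq1 hq2 using fun N : ℕ =>
    exists_tendsto_minimizers hk hn hns hnlow hsmall hu hg hB (hN N)
  have hum : ∀ N : ℕ, ∀ᶠ t in atTop,
      AEStronglyMeasurable (u t) (volume.restrict (ball 0 ((N : ℝ) + 1))) := fun N => by
    filter_upwards [eventually_ge_atTop ((N : ℝ) + 1)] with t ht
    exact ((hg t ((hN N).trans_le ht)).mono (ball_subset_ball ht)).memLp.1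
  -- The limits on two nested balls are `L²` limits of the same functions on the smaller ball.
  obtain ⟨W, hW⟩ := exists_glue (F := fun N => ⇑(q N).1) fun M N hMN => by
    have hr : (volume : Measure (E d)).restrict (ball 0 ((M : ℝ) + 1))
        ≤ volume.restrict (ball 0 ((N : ℝ) + 1)) :=
      Measure.restrict_mono_set _ (ball_natCast_subset hMN)
    refine ae_eq_of_tendsto_eLpNorm (hum M) ((Lp.memLp (q N).1).mono_measure hr).1
      (Lp.memLp (q M).1).1 ?_ (hq1 M)
    exact tendsto_of_tendsto_of_tendsto_of_le_of_le tendsto_const_nhds (hq1 N)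
      (fun _ => zero_le) fun t => eLpNorm_mono_measure _ hr
  have hWU : W =ᵐ[volume] U := by
    refine hUuniq W (isOutgoing_of_forall_ball hU.2.2.ne fun N =>
      ⟨gradOf k n (q N).1 (q N).2, IsSolPair.congr (hq N) (hW N).symm (EventuallyEq.refl _ _), ?_⟩)
    have e : radField k n W (gradOf k n (q N).1 (q N).2)
        =ᵐ[volume.restrict (ball 0 ((N : ℝ) + 1))] (q N).2 := by
      filter_upwards [hW N] with x hx
      have h1 := congrFun (radField_gradOf (k := k) (n := n) (q N).1 (q N).2) x
      rw [← h1, radField, radField, hx]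
    rw [eLpNorm_congr_ae e, ← Lp.enorm_def, ← ofReal_norm]
    exact ENNReal.ofReal_le_of_le_toReal (hqB N)
  obtain ⟨N, hNR⟩ := exists_nat_ge R
  have hsub : ball (0 : E d) R ⊆ ball 0 ((N : ℝ) + 1) := ball_subset_ball (by linarith)
  have hr := Measure.restrict_mono_set (volume : Measure (E d)) hsub
  have hqU : ⇑(q N).1 =ᵐ[volume.restrict (ball 0 ((N : ℝ) + 1))] U :=
    (hW N).symm.trans (ae_restrict_of_ae hWU)
  have hUp : IsSolPair k n (rhs f) (ball 0 ((N : ℝ) + 1)) U (gradOf k n (q N).1 (q N).2) :=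
    IsSolPair.congr (hq N) hqU (EventuallyEq.refl _ _)
  obtain ⟨a, b, ha, hb, hab⟩ := exists_eLpNorm_gradOf_le k hn ((N : ℝ) + 1)
  have hlim : Tendsto (fun t => (eLpNorm (u t - ⇑(q N).1) 2
        (volume.restrict (ball 0 ((N : ℝ) + 1))) ^ 2 +
      (a * eLpNorm (radField k n (u t) (g t) - ⇑(q N).2) 2
          (volume.restrict (ball 0 ((N : ℝ) + 1)))
        + b * eLpNorm (u t - ⇑(q N).1) 2
          (volume.restrict (ball 0 ((N : ℝ) + 1)))) ^ 2) ^ (1 / 2 : ℝ)) atTop (𝓝 0) := by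
    have h1 := (ENNReal.Tendsto.const_mul (hq2 N) (Or.inr ha)).add
      (ENNReal.Tendsto.const_mul (hq1 N) (Or.inr hb))
    have h2 := ((ENNReal.continuous_pow 2).tendsto _).comp (hq1 N)
    have h3 := ((ENNReal.continuous_pow 2).tendsto _).comp h1
    have h4 := (ENNReal.continuous_rpow_const (y := 1 / 2)).tendsto _ |>.comp (h2.add h3)
    simpa [Function.comp_def] using h4
  refine tendsto_of_tendsto_of_tendsto_of_le_of_le' tendsto_const_nhds hlim
    (Eventually.of_forall fun _ => zero_le) ?_
  filter_upwards [eventually_ge_atTop ((N : ℝ) + 1)] with t ht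
  have hs := (hg t ((hN N).trans_le ht)).mono (ball_subset_ball ht)
  have hpair := hs.toIsH1Pair.combo hUp.toIsH1Pair 1 (-1)
  have e1 : (fun x => (1 : ℂ) • u t x + (-1 : ℂ) • U x) = fun x => u t x - U x := by
    funext x
    simp [sub_eq_add_neg]
  -- Since `gradOf` is linear in the pair, the gradient of `u_t - U` comes from the differences of
  -- functions and of radiation fields, both of which tend to zero.
  have e2 : (fun x => (1 : ℂ) • g t x + (-1 : ℂ) • gradOf k n (q N).1 (q N).2 x)
      = gradOf k n (u t - ⇑(q N).1) (radField k n (u t) (g t) - ⇑(q N).2) := by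
    rw [gradOf_sub, gradOf_radField]
    funext x
    simp [sub_eq_add_neg]
  rw [e1, e2] at hpair
  have e3 : (fun x => u t x - U x) =ᵐ[volume.restrict (ball 0 ((N : ℝ) + 1))] u t - ⇑(q N).1 := by
    filter_upwards [hqU] with x hx
    rw [Pi.sub_apply, hx]
  rw [h1Norm_eq isOpen_ball (hpair.mono hsub)]
  gcongr
  · exact (eLpNorm_mono_measure _ hr).trans (eLpNorm_congr_ae e3).le
  · exact (eLpNorm_mono_measure _ hr).trans (hab _ _ (hs.memLp.sub (Lp.memLp (q N).1))
      ((memLp_radField hn hs.memLp hs.memLp_grad).sub (Lp.memLp (q N).2)))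

end Minimizers

end Helmholtz

theorem mainTheorem1 (d : ℕ) (hd : 2 ≤ d) (k : ℝ) (hk : 0 < k)
    (n : Helmholtz.E d → ℝ) (f : Helmholtz.E d → ℂ) (hf : LocallyIntegrable f volume)
    (hn : MemLp n (⊤ : ℝ≥0∞) volume)
    (nstar : ℝ) (hnstar : 0 < nstar) (hnlow : ∀ᵐ x, nstar ≤ n x)
    (hsmall : eLpNorm (fun x => 1 - Helmholtz.sphereMean n ‖x‖ / n x) (⊤ : ℝ≥0∞) volume < 1)
    (U : Helmholtz.E d → ℂ) (hU : Helmholtz.IsOutgoing k n f U)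
    (hUuniq : ∀ W : Helmholtz.E d → ℂ, Helmholtz.IsOutgoing k n f W → W =ᵐ[volume] U) :
    (∀ R : ℝ, 0 < R → ∃ u : Helmholtz.E d → ℂ, Helmholtz.IsMinimizer k n f R u ∧
      ∀ v : Helmholtz.E d → ℂ, Helmholtz.IsMinimizer k n f R v →
        v =ᵐ[volume.restrict (ball 0 R)] u) ∧
    ∀ u : ℝ → Helmholtz.E d → ℂ, (∀ R : ℝ, 0 < R → Helmholtz.IsMinimizer k n f R (u R)) →
      ∀ R₀ : ℝ, 0 < R₀ →
        Tendsto (fun R : ℝ => Helmholtz.h1Norm (ball 0 R₀) (fun x => u R x - U x)) atTop (𝓝 0) := by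
  have : Nonempty (Fin d) := ⟨⟨0, by omega⟩⟩
  refine ⟨fun R hR => ?_, fun u hu R₀ _ =>
    Helmholtz.tendsto_h1Norm_minimizers hk hn hnstar hnlow hsmall hU hUuniq hu⟩
  obtain ⟨G, hG⟩ := hU.exists_isSolPair
  -- The restriction of `U` shows that the set of solutions in the ball is nonempty.
  exact Helmholtz.existsUnique_isMinimizer hk hn hnstar hnlow hsmall hR (hG R hR).1
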